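/- Let $\mathbf{Met}$ be the category of extended metric spaces (metrics with values in $[0,\infty]$) and nonexpansive maps; $X\otimes Y$ is $X\times Y$ with the sum of the metrics, and $Y^X=[X,Y]$ is the set of nonexpansive maps $X\to Y$ with the supremum metric. A *$\mathbf{Met}$-category* is a category with an extended metric on each hom-set such that composition $\mathcal C(Y,Z)\otimes\mathcal C(X,Y)\to\mathcal C(X,Z)$ is nonexpansive; a *$\mathbf{Met}$-functor* is a functor that is nonexpansive on hom-sets. A *power* $X^V$ is an object with a nonexpansive family $V\to\mathcal C(X^V,X)$ inducing isometric bijections $\mathcal C(A,X^V)\cong[V,\mathcal C(A,X)]$ for all $A$. *Lawvere theories.* Let $\mathbf{CMet}\subseteq\mathbf{Met}$ be the full subcategory of countable spaces. A *$\mathbf{Met}$-enriched Lawvere theory* $\mathbb T$ is a $\mathbf{Met}$-category with an identity-on-objects (up to renaming, i.e. bijective on objects) $\mathbf{Met}$-functor $F:\mathbf{CMet}^{op}\to\mathbb T$ preserving powers by countable spaces. Write $x^A=F(A)$ and $x=F(*)$ with $*$ the one-point space; for $i\in A$ the projection $\pi_i:x^A\to x$ is the image of the map $*\to A$ picking out $i$.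 $Mod(\mathbb T)$ is the category of $\mathbf{Met}$-functors $M:\mathbb T\to\mathbf{Met}$ preserving powers by countable spaces, and natural transformations, with forgetful functor $M\mapsto M(x)$. *Metric equational theories.* A *metric cardinal* is a countable cardinal with an extended metric. A *metric signature* $\Omega$ is a set of operation symbols, each with a metric cardinal as its arity. Preterms over a set of variables are built inductively from variables and from $f((t_i)_{i\in N})$ with $f$ of arity $N$. Fix a countably infinite set of variables. A *context* $\Gamma$ is a finite or countably infinite list of expressions $y=_\varepsilon z$ with $y,z$ variables and $\varepsilon\in\mathbb R_{\ge0}$. *Judgments* are $\Gamma\vdash t\ ok$ and $\Gamma\vdash s=_\varepsilon t$ with $s,t$ preterms. For a set $S$ of judgments, $\vdash_S$ is the least set of judgments that contains $S$ and is closed under the following rules (where $d(i,j)$ is the distance in the arity $N$ of $f$, and a premise mentioning $d(i,j)$ is only required if $d(i,j)<\infty$): - $\Gamma\vdash y\ ok$ for each variable $y$; $\Gamma\vdash y=_\varepsilon z$ if this equality is in $\Gamma$; - if $\Gamma\vdash t\ ok$ then $\Gamma\vdash t=_0t$; if $\Gamma\vdash s=_\varepsilon t$ then $\Gamma\vdash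 t=_\varepsilon s$; if $\Gamma\vdash s=_\varepsilon t$ and $\Gamma\vdash t=_{\varepsilon'}r$ then $\Gamma\vdash s=_{\varepsilon+\varepsilon'}r$; - if $\varepsilon'<\varepsilon$ and $\Gamma\vdash s=_{\varepsilon'}t$ then $\Gamma\vdash s=_\varepsilon t$; if $\Gamma\vdash s=_{\varepsilon'}t$ for all $\varepsilon'>\varepsilon$ then $\Gamma\vdash s=_\varepsilon t$; - if $\Gamma\vdash s_i=_{d(i,j)}s_j$, $\Gamma\vdash t_i=_{d(i,j)}t_j$ and $\Gamma\vdash s_i=_\varepsilon t_i$ for all $i,j\in N$, then $\Gamma\vdash f((s_i))=_\varepsilon f((t_i))$; - if $\Gamma\vdash t_i\ ok$ and $\Gamma\vdash t_i=_{d(i,j)}t_j$ for all $i,j\in N$, then $\Gamma\vdash f((t_i))\ ok$; - if $\sigma$ assigns a preterm to each variable, $\Gamma\vdash\sigma(y)\ ok$ for all variables $y$, $\Gamma\vdash\sigma(y)=_\delta\sigma(z)$ for all equalities $y=_\delta z$ in a context $\Delta$, and $\Delta\vdash s=_\varepsilon t$, then $\Gamma\vdash s[\sigma]=_\varepsilon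 t[\sigma]$. A set $T$ of judgments is a *metric equational theory* (MET) if $\Gamma\vdash s=_\varepsilon t$ in $T$ implies that $\Gamma\vdash s\ ok$ and $\Gamma\vdash t\ ok$ are in $T$, and $T=\ \vdash_{T^=}$, where $T^=\subseteq T$ is the subset of equational judgments. A *model* of $\Omega$ is a metric space $M$ with nonexpansive maps $M[f]:M^N\to M$ for all $f$ of arity $N$; homomorphisms are nonexpansive maps commuting with the operations. Let $M^\Gamma$ be the set of assignments $\alpha$ of the variables in $M$ with $d(\alpha(y),\alpha(z))\le\varepsilon$ for all $y=_\varepsilon z$ in $\Gamma$. $M$ satisfies $\Gamma\vdash y\ ok$ for each variable $y$, with $M[y](\alpha)=\alpha(y)$; it satisfies $\Gamma\vdash f((t_i))\ ok$ iff it satisfies each $\Gamma\vdash t_i\ ok$ and $\sup_{\alpha\in M^\Gamma}d(M[t_i](\alpha),M[t_j](\alpha))\le d(i,j)$ for all $i,j$, and then $M[f((t_i))](\alpha)=M[f]((M[t_i](\alpha))_i)$; it satisfies $\Gamma\vdash s=_\varepsilon t$ iff it satisfies $\Gamma\vdash s\ ok$ and $\Gamma\vdash t\ ok$ and $\sup_{\alpha\in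 M^\Gamma}d(M[s](\alpha),M[t](\alpha))\le\varepsilon$. $Mod(T)$ is the full subcategory of the models of $\Omega$ that satisfy all judgments in $T$, with its forgetful functor to $\mathbf{Met}$. *The theory $T(\mathbb T)$.* Fix distinct variables $x_0,x_1,\dots$, and for a metric cardinal $C$ let $\Gamma(C)=\{x_i=_{d_C(i,j)}x_j\mid i,j\in C,\ d_C(i,j)<\infty\}$. The signature has one symbol $[f]$ of arity $C$ for each metric cardinal $C$ and each morphism $f:x^C\to x$ of $\mathbb T$. $T(\mathbb T)=\ \vdash_S$, where $S$ consists of the axioms 1. $\Gamma(C)\vdash[f](x_0,x_1,\dots)=_{d(f,f')}[f'](x_0,x_1,\dots)$ for $f,f':x^C\to x$ with $d(f,f')<\infty$; 2. $\Gamma(C)\vdash[\pi_i](x_0,x_1,\dots)=_0x_i$ for $i\in C$; 3. $\Gamma(D)\vdash[f]\big(([g_i](x_0,x_1,\dots))_{i\in C}\big)=_0[f\circ g](x_0,x_1,\dots)$ for $f:x^C\to x$ and $g:x^D\to x^C$, where $g_i=\pi_i\circ g$. **Proposition.** (a) For every $\mathbf{Met}$-enriched Lawvere theory $\mathbb T$,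 $T(\mathbb T)$ is a metric equational theory, and there is an equivalence of categories $E:Mod(\mathbb T)\simeq Mod(T(\mathbb T))$ which commutes with the forgetful functors to $\mathbf{Met}$ and is an isometry on hom-sets, where natural transformations and homomorphisms carry the supremum metrics. (b) Let $R$ be a strong monad on $\mathbf{Met}$, that is, a monad whose underlying functor is a $\mathbf{Met}$-functor. Then there is a metric equational theory $T$ such that the forgetful functor $Mod(T)\to\mathbf{Met}$ has a left adjoint and the monad of this adjunction is isomorphic to $R$, if and only if $R$ is of countable arity, that is, preserves countably filtered ($\aleph_1$-filtered) colimits. -/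

import Mathlib

open CategoryTheory
open scoped ENNReal NNReal

universe u v w v' w'

noncomputable section

namespace MetEq

/-! ### The category of extended metric spaces and nonexpansive maps -/

/-- The internal hom `[X, Y]`: nonexpansive maps with the supremum metric. -/
@[ext]
structure NExp (X : Type v) (Y : Type w) [EMetricSpace X] [EMetricSpace Y] where
  toFun : X → Y
  nonexp : LipschitzWith 1 toFun

instance {X : Type v} {Y : Type w} [EMetricSpace X] [EMetricSpace Y] : FunLike (NExp X Y) X Y where
  coe := NExp.toFun
  coe_injective _ _ h := NExp.ext h

/-- The supremum distance of two functions. -/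
def supDist {X : Type v} {Y : Type w} [EDist Y] (f g : X → Y) : ℝ≥0∞ :=
  ⨆ x, edist (f x) (g x)

lemma supDist_self {X : Type v} {Y : Type w} [EMetricSpace Y] (f : X → Y) : supDist f f = 0 := by
  simp [supDist]

lemma supDist_comm {X : Type v} {Y : Type w} [EMetricSpace Y] (f g : X → Y) :
    supDist f g = supDist g f := by
  simp [supDist, edist_comm]

lemma supDist_triangle {X : Type v} {Y : Type w} [EMetricSpace Y] (f g h : X → Y) :
    supDist f h ≤ supDist f g + supDist g h :=
  iSup_le fun x => (edist_triangle _ (g x) _).trans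
    (add_le_add (le_iSup (fun x => edist (f x) (g x)) x) (le_iSup (fun x => edist (g x) (h x)) x))

lemma eq_of_supDist {X : Type v} {Y : Type w} [EMetricSpace Y] {f g : X → Y}
    (h : supDist f g = 0) : f = g := by
  funext x
  exact eq_of_edist_eq_zero (le_antisymm (h ▸ le_iSup (fun x => edist (f x) (g x)) x) bot_le)

instance {X : Type v} {Y : Type w} [EMetricSpace X] [EMetricSpace Y] :
    EMetricSpace (NExp X Y) where
  edist f g := supDist f.toFun g.toFun
  edist_self f := supDist_self _
  edist_comm f g := supDist_comm _ _
  edist_triangle f g h := supDist_triangle _ _ _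
  eq_of_edist_eq_zero h := NExp.ext (eq_of_supDist h)

/-- Composition of nonexpansive maps (in diagrammatic order). -/
def NExp.comp {X : Type v} {Y : Type w} {Z : Type v'} [EMetricSpace X] [EMetricSpace Y]
    [EMetricSpace Z] (f : NExp X Y) (g : NExp Y Z) : NExp X Z where
  toFun x := g.toFun (f.toFun x)
  nonexp := by simpa [Function.comp_def] using g.nonexp.comp f.nonexp

/-- Extended metric spaces. -/
structure Met : Type (u + 1) where
  carrier : Type u
  [metric : EMetricSpace carrier]

attribute [instance] Met.metric

instance : CoeSort Met.{u} (Type u) := ⟨Met.carrier⟩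

instance : Category.{u} Met.{u} where
  Hom X Y := NExp X Y
  id X := ⟨fun x => x, LipschitzWith.id⟩
  comp f g := f.comp g

/-! ### Categories enriched in `Met` -/

/-- A `Met`-enriched category: a category with an extended metric on each hom-set such that
composition `C(Y, Z) ⊗ C(X, Y) → C(X, Z)` is nonexpansive, where the metric of a tensor product
is the sum of the metrics. -/
class MetCategory (C : Type w) extends Category.{v} C where
  homMetric (X Y : C) : EMetricSpace (X ⟶ Y)
  edist_comp_le {X Y Z : C} (f f' : X ⟶ Y) (g g' : Y ⟶ Z) :
    edist (f ≫ g) (f' ≫ g') ≤ edist f f' + edist g g'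

attribute [reducible, instance] MetCategory.homMetric

instance : MetCategory.{u} Met.{u} where
  homMetric X Y := inferInstanceAs (EMetricSpace (NExp X Y))
  edist_comp_le {X Y Z} f f' g g' := by
    refine iSup_le fun x => (edist_triangle _ (g.toFun (f'.toFun x)) _).trans (add_le_add ?_ ?_)
    · refine (g.nonexp (f.toFun x) (f'.toFun x)).trans ?_
      rw [ENNReal.coe_one, one_mul]
      exact le_iSup (fun x => edist (f.toFun x) (f'.toFun x)) x
    · exact le_iSup (fun y => edist (g.toFun y) (g'.toFun y)) (f'.toFun x)

/-- The opposite of a `Met`-category. -/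
instance {C : Type w} [MetCategory.{v} C] : MetCategory.{v} Cᵒᵖ where
  homMetric X Y := EMetricSpace.induced (fun f : X ⟶ Y => f.unop) Quiver.Hom.unop_inj inferInstance
  edist_comp_le {X Y Z} f f' g g' := by
    change edist (g.unop ≫ f.unop) (g'.unop ≫ f'.unop) ≤ edist f.unop f'.unop + edist g.unop g'.unop
    rw [add_comm]
    exact MetCategory.edist_comp_le _ _ _ _

/-- A full subcategory of a `Met`-category inherits the enrichment. -/
instance instMetCategoryFullSubcategory {C : Type w} [MetCategory.{v} C] (P : ObjectProperty C) :
    MetCategory.{v} P.FullSubcategory where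
  homMetric X Y := EMetricSpace.induced (fun f : X ⟶ Y => f.hom)
    (fun _ _ h => ObjectProperty.hom_ext P h) inferInstance
  edist_comp_le {X Y Z} f f' g g' := by
    change edist (f.hom ≫ g.hom) (f'.hom ≫ g'.hom) ≤ edist f.hom f'.hom + edist g.hom g'.hom
    exact MetCategory.edist_comp_le _ _ _ _

/-- The metric on natural transformations: the supremum of the distances of the components. -/
instance {C : Type w} [Category.{v} C] {D : Type w'} [MetCategory.{v'} D] :
    MetCategory.{max w v'} (C ⥤ D) where
  homMetric F G :=
    { edist := fun α β => ⨆ X, edist (α.app X) (β.app X)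
      edist_self := fun α => by simp
      edist_comm := fun α β => by simp [edist_comm]
      edist_triangle := fun α β γ => iSup_le fun X => (edist_triangle _ (β.app X) _).trans
        (add_le_add (le_iSup (fun X => edist (α.app X) (β.app X)) X)
          (le_iSup (fun X => edist (β.app X) (γ.app X)) X))
      eq_of_edist_eq_zero := fun {α β} h => by
        ext X
        exact eq_of_edist_eq_zero
          (le_antisymm (h ▸ le_iSup (fun X => edist (α.app X) (β.app X)) X) bot_le) }
  edist_comp_le {F G H} α α' β β' :=
    iSup_le fun X => (MetCategory.edist_comp_le (α.app X) (α'.app X) (β.app X) (β'.app X)).trans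
      (add_le_add (le_iSup (fun X => edist (α.app X) (α'.app X)) X)
        (le_iSup (fun X => edist (β.app X) (β'.app X)) X))

/-- An enriched (strong) functor between `Met`-categories: it is nonexpansive on each hom-set. -/
def IsMetFunctor {C : Type w} [MetCategory.{v} C] {D : Type w'} [MetCategory.{v'} D]
    (F : C ⥤ D) : Prop :=
  ∀ ⦃X Y : C⦄ (f g : X ⟶ Y), edist (F.map f) (F.map g) ≤ edist f g

/-- `P`, with the cone `l : V → C(P, X)`, is a power `X ^ V`: the map `h ↦ (v ↦ h ≫ l v)` is an
isomorphism of metric spaces from `C(A, P)` to `[V, C(A, X)]`, for each object `A`. -/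
structure IsPower (V : Type u) [EMetricSpace V] {C : Type w} [MetCategory.{v} C] (X P : C)
    (l : V → (P ⟶ X)) : Prop where
  nonexp : LipschitzWith 1 l
  isometry (A : C) (h h' : A ⟶ P) : edist h h' = supDist (fun a => h ≫ l a) (fun a => h' ≫ l a)
  lift (A : C) (g : V → (A ⟶ X)) : LipschitzWith 1 g → ∃ h : A ⟶ P, ∀ a, h ≫ l a = g a

/-- A functor preserving powers by countable metric spaces (in the universe `u`). -/
def PreservesCountablePowers {C : Type w} [MetCategory.{v} C] {D : Type w'} [MetCategory.{v'} D]
    (F : C ⥤ D) : Prop :=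
  ∀ (V : Type u) [EMetricSpace V] [Countable V] (X P : C) (l : V → (P ⟶ X)),
    IsPower V X P l → IsPower V (F.obj X) (F.obj P) (fun a => F.map (l a))

/-! ### Lawvere theories over `Met` -/

/-- The category of countable extended metric spaces. -/
abbrev CMet : Type (u + 1) := ObjectProperty.FullSubcategory (fun X : Met.{u} => Countable X)

/-- The one-point space. -/
def CMet.point : CMet.{u} := ⟨⟨PUnit⟩, inferInstance⟩

/-- The map from the one-point space that picks out an element. -/
def CMet.const {A : CMet.{u}} (a : A.obj) : CMet.point ⟶ A :=
  ObjectProperty.homMk (P := fun X : Met.{u} => Countable X) (X := CMet.point) (Y := A)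
    (⟨fun _ => a, LipschitzWith.const' a⟩ : NExp PUnit A.obj)

/-- A Lawvere theory over `Met`: a `Met`-category `Obj` with an enriched functor `CMetᵒᵖ ⥤ Obj`
that preserves powers by countable spaces and identifies the objects of `Obj` with those
of `CMetᵒᵖ`. -/
structure LawvereTheory where
  Obj : Type (u + 1)
  [cat : MetCategory.{u} Obj]
  incl : CMet.{u}ᵒᵖ ⥤ Obj
  bijective_obj : Function.Bijective incl.obj
  isMetFunctor : IsMetFunctor incl
  preservesPowers : PreservesCountablePowers.{u} incl

attribute [instance] LawvereTheory.cat

namespace LawvereTheory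

variable (L : LawvereTheory.{u})

/-- The object `x ^ A`. -/
def pow (A : CMet.{u}) : L.Obj := L.incl.obj (Opposite.op A)

/-- The generating object `x`. -/
def x : L.Obj := L.pow CMet.point

/-- The projection `x ^ A ⟶ x` to the component `a`. -/
def proj {A : CMet.{u}} (a : A.obj) : L.pow A ⟶ L.x := L.incl.map (CMet.const a).op

/-- The category of models: enriched functors to `Met` preserving powers by countable spaces, and
their natural transformations. -/
abbrev Model : Type _ :=
  ObjectProperty.FullSubcategory
    (fun M : L.Obj ⥤ Met.{u} => IsMetFunctor M ∧ PreservesCountablePowers.{u} M)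

/-- Natural transformations of models carry the supremum metric. -/
instance : MetCategory.{u + 1} L.Model :=
  instMetCategoryFullSubcategory (C := L.Obj ⥤ Met.{u}) _

/-- The forgetful functor `M ↦ M(x)`. -/
def forget : L.Model ⥤ Met.{u} :=
  ObjectProperty.ι _ ⋙ (evaluation L.Obj Met.{u}).obj L.x

end LawvereTheory

/-! ### Metric equational theories -/

/-- A countable cardinal with an extended metric on the set `{k : ℕ | k < card}`. -/
structure MetricCardinal : Type where
  card : ℕ∞
  metric : EMetricSpace {k : ℕ // (k : ℕ∞) < card}

/-- The underlying set of a metric cardinal. -/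
def MetricCardinal.carrier (C : MetricCardinal) : Type := {k : ℕ // (k : ℕ∞) < C.card}

instance : CoeSort MetricCardinal Type := ⟨MetricCardinal.carrier⟩

instance (C : MetricCardinal) : EMetricSpace C := C.metric

instance (C : MetricCardinal) : Countable C := inferInstanceAs (Countable {k : ℕ // (k : ℕ∞) < C.card})

/-- A metric cardinal as a countable metric space. -/
def MetricCardinal.toCMet (C : MetricCardinal) : CMet.{u} :=
  ⟨⟨ULift.{u} C⟩, inferInstanceAs (Countable (ULift.{u} C))⟩

/-- A metric signature: a set of operation symbols with metric arities. -/
structure Signature where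
  Op : Type u
  arity : Op → MetricCardinal

/-- Preterms over a set of variables. -/
inductive Preterm (Ω : Signature.{u}) (X : Type v) : Type (max u v)
  | var (x : X) : Preterm Ω X
  | op (f : Ω.Op) (t : Ω.arity f → Preterm Ω X) : Preterm Ω X

/-- Simultaneous substitution. -/
def Preterm.subst {Ω : Signature.{u}} {X : Type v} {Y : Type w} (σ : X → Preterm Ω Y) :
    Preterm Ω X → Preterm Ω Y
  | .var x => σ x
  | .op f t => .op f (fun i => (t i).subst σ)

/-- A context over a set of variables: a countable set of quantitative equalities `x =_ε y`,
written as triples `(x, ε, y)`. -/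
structure Context (X : Type v) where
  eqs : Set (X × ℝ≥0 × X)
  countable : eqs.Countable

/-- An assignment satisfies a context if it satisfies all of its equalities. -/
def Context.Sat {X : Type v} (Γ : Context X) {M : Type w} [EMetricSpace M] (α : X → M) : Prop :=
  ∀ x ε y, (x, ε, y) ∈ Γ.eqs → edist (α x) (α y) ≤ (ε : ℝ≥0∞)

/-- Judgments, with the natural numbers as the set of variables: `ok Γ t` is `Γ ⊢ t ok`, and
`eq Γ s ε t` is `Γ ⊢ s =_ε t`. -/
inductive Judgment (Ω : Signature.{u}) : Type u
  | ok (Γ : Context ℕ) (t : Preterm Ω ℕ) : Judgment Ω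
  | eq (Γ : Context ℕ) (s : Preterm Ω ℕ) (ε : ℝ≥0) (t : Preterm Ω ℕ) : Judgment Ω

/-- The least deducibility relation containing `S`. In the rules with a metric arity, infinite
distances impose no condition. -/
inductive Deducible {Ω : Signature.{u}} (S : Set (Judgment Ω)) : Judgment Ω → Prop
  | ax {J : Judgment Ω} : J ∈ S → Deducible S J
  | var (Γ : Context ℕ) (x : ℕ) : Deducible S (.ok Γ (.var x))
  | assum (Γ : Context ℕ) (x : ℕ) (ε : ℝ≥0) (y : ℕ) :
      (x, ε, y) ∈ Γ.eqs → Deducible S (.eq Γ (.var x) ε (.var y))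
  | refl (Γ : Context ℕ) (t : Preterm Ω ℕ) : Deducible S (.ok Γ t) → Deducible S (.eq Γ t 0 t)
  | symm (Γ : Context ℕ) (s t : Preterm Ω ℕ) (ε : ℝ≥0) :
      Deducible S (.eq Γ s ε t) → Deducible S (.eq Γ t ε s)
  | triang (Γ : Context ℕ) (s t r : Preterm Ω ℕ) (ε ε' : ℝ≥0) :
      Deducible S (.eq Γ s ε t) → Deducible S (.eq Γ t ε' r) → Deducible S (.eq Γ s (ε + ε') r)
  | max (Γ : Context ℕ) (s t : Preterm Ω ℕ) (ε ε' : ℝ≥0) :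
      ε' < ε → Deducible S (.eq Γ s ε' t) → Deducible S (.eq Γ s ε t)
  | cont (Γ : Context ℕ) (s t : Preterm Ω ℕ) (ε : ℝ≥0) :
      (∀ ε' : ℝ≥0, ε < ε' → Deducible S (.eq Γ s ε' t)) → Deducible S (.eq Γ s ε t)
  | nexp (Γ : Context ℕ) (f : Ω.Op) (s t : Ω.arity f → Preterm Ω ℕ) (ε : ℝ≥0) :
      (∀ (i j : Ω.arity f) (δ : ℝ≥0), edist i j = δ → Deducible S (.eq Γ (s i) δ (s j))) →
      (∀ (i j : Ω.arity f) (δ : ℝ≥0), edist i j = δ → Deducible S (.eq Γ (t i) δ (t j))) →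
      (∀ i : Ω.arity f, Deducible S (.eq Γ (s i) ε (t i))) →
      Deducible S (.eq Γ (.op f s) ε (.op f t))
  | subst (Γ Δ : Context ℕ) (σ : ℕ → Preterm Ω ℕ) (s t : Preterm Ω ℕ) (ε : ℝ≥0) :
      (∀ x, Deducible S (.ok Γ (σ x))) →
      (∀ x δ y, (x, δ, y) ∈ Δ.eqs → Deducible S (.eq Γ (σ x) δ (σ y))) →
      Deducible S (.eq Δ s ε t) → Deducible S (.eq Γ (s.subst σ) ε (t.subst σ))
  | app (Γ : Context ℕ) (f : Ω.Op) (t : Ω.arity f → Preterm Ω ℕ) :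
      (∀ i, Deducible S (.ok Γ (t i))) →
      (∀ (i j : Ω.arity f) (δ : ℝ≥0), edist i j = δ → Deducible S (.eq Γ (t i) δ (t j))) →
      Deducible S (.ok Γ (.op f t))

/-- The subset of equational judgments. -/
def equational {Ω : Signature.{u}} (T : Set (Judgment Ω)) : Set (Judgment Ω) :=
  {J ∈ T | ∃ Γ s ε t, J = .eq Γ s ε t}

/-- Well-formed collections of judgments. -/
def WellFormed {Ω : Signature.{u}} (T : Set (Judgment Ω)) : Prop :=
  ∀ Γ s ε t, .eq Γ s ε t ∈ T → .ok Γ s ∈ T ∧ .ok Γ t ∈ T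

/-- A metric equational theory: a well-formed collection of judgments that is the least
deducibility relation containing its equational judgments. -/
def IsMET {Ω : Signature.{u}} (T : Set (Judgment Ω)) : Prop :=
  WellFormed T ∧ T = {J | Deducible (equational T) J}

/-- A model of a signature: a metric space `M` with a nonexpansive map `M ^ A → M` for each
operation symbol of arity `A`. -/
structure SigModel (Ω : Signature.{u}) where
  space : Met.{u}
  op (f : Ω.Op) : NExp (NExp (Ω.arity f) space) space

/-- Homomorphisms of models of a signature. -/
@[ext]
structure SigModel.Hom {Ω : Signature.{u}} (M N : SigModel Ω) where
  toNExp : NExp M.space N.space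
  map_op (f : Ω.Op) (m : NExp (Ω.arity f) M.space) : toNExp (M.op f m) = N.op f (m.comp toNExp)

instance {Ω : Signature.{u}} : Category.{u} (SigModel Ω) where
  Hom M N := SigModel.Hom M N
  id M := ⟨⟨fun x => x, LipschitzWith.id⟩, fun _ _ => rfl⟩
  comp {M N K} φ ψ := ⟨φ.toNExp.comp ψ.toNExp, fun f m => by
    change ψ.toNExp (φ.toNExp (M.op f m)) = K.op f ((m.comp φ.toNExp).comp ψ.toNExp)
    rw [φ.map_op, ψ.map_op]⟩

/-- The underlying space of a model of a signature. -/
def SigModel.forget (Ω : Signature.{u}) : SigModel Ω ⥤ Met.{u} where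
  obj M := M.space
  map φ := φ.toNExp

/-- Homomorphisms carry the supremum metric. -/
instance {Ω : Signature.{u}} : MetCategory.{u} (SigModel Ω) where
  homMetric M N := EMetricSpace.induced (fun φ : SigModel.Hom M N => φ.toNExp)
    (fun _ _ h => SigModel.Hom.ext h) inferInstance
  edist_comp_le {M N K} φ φ' ψ ψ' :=
    MetCategory.edist_comp_le (C := Met.{u}) (X := M.space) (Y := N.space) (Z := K.space)
      φ.toNExp φ'.toNExp ψ.toNExp ψ'.toNExp

namespace SigModel

variable {Ω : Signature.{u}} (M : SigModel Ω)

/-- Assignments of the variables in `M` that satisfy the context `Γ`; these are the nonexpansive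
maps to `M` from the metric space presented by `Γ`. -/
def Assignment (Γ : Context ℕ) : Type u := {α : ℕ → M.space // Γ.Sat α}

/-- The interpretation of a preterm `t` in context `Γ`. The value `M[t] : Assignment Γ → M` is
defined exactly if `M` satisfies `Γ ⊢ t ok`: for `t = f (t i)ᵢ` each `M[t i]` has to be
defined, and the supremum distance of `M[t i]` and `M[t j]` has to be at most `d(i, j)`. -/
def interp (Γ : Context ℕ) : Preterm Ω ℕ → Part (M.Assignment Γ → M.space)
  | .var x => Part.some fun α => α.1 x
  | .op f t =>
    ⟨∃ h : ∀ i, (interp Γ (t i)).Dom,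
        ∀ i j, supDist ((interp Γ (t i)).get (h i)) ((interp Γ (t j)).get (h j)) ≤ edist i j,
      fun h α => M.op f
        ⟨fun i => (interp Γ (t i)).get (h.fst i) α, fun i j => by
          rw [ENNReal.coe_one, one_mul]
          exact (le_iSup (fun α => edist ((interp Γ (t i)).get (h.fst i) α)
            ((interp Γ (t j)).get (h.fst j) α)) α).trans (h.snd i j)⟩⟩

/-- Satisfaction of a judgment. -/
def Satisfies : Judgment Ω → Prop
  | .ok Γ t => (M.interp Γ t).Dom
  | .eq Γ s ε t => ∃ (hs : (M.interp Γ s).Dom) (ht : (M.interp Γ t).Dom),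
      supDist ((M.interp Γ s).get hs) ((M.interp Γ t).get ht) ≤ (ε : ℝ≥0∞)

end SigModel

/-- The category of models of a collection of judgments: the full subcategory of the models of the
signature which satisfy all of its judgments. -/
abbrev TheoryModel {Ω : Signature.{u}} (T : Set (Judgment Ω)) : Type (u + 1) :=
  ObjectProperty.FullSubcategory (fun M : SigModel Ω => ∀ J ∈ T, M.Satisfies J)

/-- The forgetful functor to metric spaces. -/
def TheoryModel.forget {Ω : Signature.{u}} (T : Set (Judgment Ω)) : TheoryModel T ⥤ Met.{u} :=
  ObjectProperty.ι _ ⋙ SigModel.forget Ω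

/-! ### The metric equational theory of a Lawvere theory -/

/-- The context `{x_i =_{d(i, j)} x_j | i, j ∈ C, d(i, j) < ∞}`. -/
def MetricCardinal.context (C : MetricCardinal) : Context ℕ where
  eqs := Set.range fun p : {p : C × C // edist p.1 p.2 ≠ ⊤} =>
    (p.1.1.val, (edist p.1.1 p.1.2).toNNReal, p.1.2.val)
  countable := Set.countable_range _

namespace LawvereTheory

variable (L : LawvereTheory.{u})

/-- The signature with a symbol `[f]` of arity `C` for each metric cardinal `C` and each morphism
`f : x ^ C ⟶ x`. -/
def signature : Signature.{u} where
  Op := Σ C : MetricCardinal, (L.pow C.toCMet ⟶ L.x)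
  arity f := f.1

/-- The preterm `[f](x_0, x_1, …)`. -/
def basic {C : MetricCardinal} (f : L.pow C.toCMet ⟶ L.x) : Preterm L.signature ℕ :=
  .op (Ω := L.signature) ⟨C, f⟩ fun i => .var i.val

/-- The axioms. In `comp`, the morphism `g : x ^ D ⟶ x ^ C` is the one which corresponds to the
tuple of the `g i : x ^ D ⟶ x`, so that `g ≫ f` is the composite of `f` with this tuple. -/
inductive Axioms : Judgment L.signature → Prop
  | dist {C : MetricCardinal} (f f' : L.pow C.toCMet ⟶ L.x) (ε : ℝ≥0) (h : edist f f' = ε) :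
      Axioms (.eq C.context (L.basic f) ε (L.basic f'))
  | proj {C : MetricCardinal} (i : C) :
      Axioms (.eq C.context (L.basic (L.proj (A := C.toCMet) (ULift.up i))) 0 (.var i.val))
  | comp {C D : MetricCardinal} (f : L.pow C.toCMet ⟶ L.x)
      (g : C → (L.pow D.toCMet ⟶ L.x)) (g' : L.pow D.toCMet ⟶ L.pow C.toCMet)
      (h : ∀ i : C, g' ≫ L.proj (A := C.toCMet) (ULift.up i) = g i) :
      Axioms (.eq D.context (.op (Ω := L.signature) ⟨C, f⟩ fun i => L.basic (g i)) 0
        (L.basic (g' ≫ f)))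

/-- The metric equational theory generated by the axioms. -/
def theory : Set (Judgment L.signature) := {J | Deducible {J | L.Axioms J} J}

end LawvereTheory

/-! ### Monads -/

/-- A monad on `Met` comes from the metric equational theory `T` if the forgetful functor of `T`
has a left adjoint and the monad is isomorphic to the monad of this adjunction. -/
def ComesFrom (R : Monad Met.{u}) {Ω : Signature.{u}} (T : Set (Judgment Ω)) : Prop :=
  ∃ (F : Met.{u} ⥤ TheoryModel T) (adj : F ⊣ TheoryModel.forget T), Nonempty (adj.toMonad ≅ R)

instance fact_aleph_one_isRegular : Fact (Cardinal.aleph 1 : Cardinal.{u}).IsRegular :=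
  ⟨Cardinal.isRegular_aleph_one⟩

/-- A functor on `Met` of countable arity: it preserves countably filtered
(i.e. `ℵ₁`-filtered) colimits. -/
def CountableArity (F : Met.{u} ⥤ Met.{u}) : Prop :=
  F.IsCardinalAccessible (Cardinal.aleph 1 : Cardinal.{u})

end MetEq

end

noncomputable section

namespace MetEq

open Limits

/-! ### Nonexpansive maps -/

/-! For (a), every object of a Lawvere theory is a countable power of `x`, and up to isomorphism a
power `x ^ C` by a metric cardinal (`exists_presentation`). A model `M` identifies `M(x ^ C)` with
`[C, M(x)]`, so `M(x)` with the operations `M(f)` satisfies the axioms; this is `toTheory`. Since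
projections determine the points and distances of a power, a natural transformation is controlled by
its component at `x`: this gives the isometry on hom-sets, hence faithfulness, and also fullness.
For essential surjectivity, the axioms make the model represented by a power of `x` by `W` free on
`W` (`RepHom.exists_val`, `RepHom.edist_le`). Hence `X ↦ Hom(L(X, x), N)` preserves countable
powers, and evaluation at the identity of `x` identifies its value at `x` with `N`.

For (b), the key notion is `IsTight`. In an `ℵ₁`-filtered colimit of metric spaces the distance is
an infimum over stages; a minimizing sequence of stages has an upper bound, so the infimum is
attained. Hence countable families lift to a stage without increase of distances. Operations have
countable arities and assignments have countably many variables, so models of a theory are closed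
under such colimits formed in `Met`. The forgetful functor therefore preserves them, its left
adjoint preserves all colimits, and the monad has countable arity.

Conversely, the elements of `R(C)` act on each algebra as operations of arity `C`. The judgments
valid in all algebras form a theory (`isMET_of_models`). A model `N` of it is not assumed to be an
algebra, but it inherits the unit and associativity laws for countable arities (`eta_actHom`,
`act_mu`). By countable arity, each point of `R(X)` is `R(m)(r)` for some `m : C → X` and `r ∈
R(C)`, and distances in `R(X)` are attained on countable subspaces. So a map `h : X → N` extends to
`R(X)` by letting `r` act on the tuple `m ≫ h`: the free model on `X` is `R(X)`. -/

lemma NExp.edist_le {X : Type v} {Y : Type w} [EMetricSpace X] [EMetricSpace Y] (f : NExp X Y)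
    (x y : X) : edist (f.toFun x) (f.toFun y) ≤ edist x y := by
  simpa using f.nonexp x y

/-- A nonexpansive map from a bound on distances. -/
def NExp.mk' {X : Type v} {Y : Type w} [EMetricSpace X] [EMetricSpace Y] (f : X → Y)
    (h : ∀ x y, edist (f x) (f y) ≤ edist x y) : NExp X Y :=
  ⟨f, fun x y => by simpa using h x y⟩

lemma lipschitz_one_iff {X : Type v} {Y : Type w} [EMetricSpace X] [EMetricSpace Y] (f : X → Y) :
    LipschitzWith 1 f ↔ ∀ x y, edist (f x) (f y) ≤ edist x y := by
  simp [LipschitzWith]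

lemma NExp.edist_apply_le {X : Type v} {Y : Type w} [EMetricSpace X] [EMetricSpace Y]
    (f g : NExp X Y) (x : X) : edist (f.toFun x) (g.toFun x) ≤ edist f g :=
  le_iSup (fun x => edist (f.toFun x) (g.toFun x)) x

lemma NExp.edist_le_iff {X : Type v} {Y : Type w} [EMetricSpace X] [EMetricSpace Y]
    (f g : NExp X Y) (r : ℝ≥0∞) : edist f g ≤ r ↔ ∀ x, edist (f.toFun x) (g.toFun x) ≤ r :=
  iSup_le_iff

lemma supDist_le_iff {X : Type v} {Y : Type w} [EMetricSpace Y] (f g : X → Y) (r : ℝ≥0∞) :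
    supDist f g ≤ r ↔ ∀ x, edist (f x) (g x) ≤ r :=
  iSup_le_iff

lemma NExp.ext_apply {X : Type v} {Y : Type w} [EMetricSpace X] [EMetricSpace Y]
    {f g : NExp X Y} (h : ∀ x, f.toFun x = g.toFun x) : f = g :=
  NExp.ext (funext h)

lemma Met.hom_ext {X Y : Met.{u}} {f g : X ⟶ Y} (h : ∀ x : X, f.toFun x = g.toFun x) : f = g :=
  NExp.ext (funext h)

@[simp] lemma Met.comp_toFun {X Y Z : Met.{u}} (f : X ⟶ Y) (g : Y ⟶ Z) (x : X) :
    (f ≫ g).toFun x = g.toFun (f.toFun x) := rfl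

@[simp] lemma Met.id_toFun {X : Met.{u}} (x : X) : NExp.toFun (𝟙 X) x = x := rfl

lemma Met.edist_hom_le {X Y : Met.{u}} (f : X ⟶ Y) (x y : X) :
    edist (f.toFun x) (f.toFun y) ≤ edist x y := NExp.edist_le f x y

lemma Met.congr_toFun {X Y : Met.{u}} {f g : X ⟶ Y} (h : f = g) (x : X) :
    f.toFun x = g.toFun x := by rw [h]

/-! ### Countably filtered colimits of metric spaces -/

lemma hasCardinalLT_aleph_one (K : Type v) [Countable K] :
    HasCardinalLT K (Cardinal.aleph 1 : Cardinal.{u}) := by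
  rw [HasCardinalLT]
  simp

variable {J : Type v} [Category.{v'} J]

/-- A cocone of metric spaces is tight if it is jointly surjective and the distance of two
points is attained at some stage. -/
structure IsTight {F : J ⥤ Met.{u}} (c : Cocone F) : Prop where
  surj (p : c.pt) : ∃ j, ∃ x : F.obj j, (c.ι.app j).toFun x = p
  dist (j : J) (x y : F.obj j) : ∃ (k : J) (f : j ⟶ k),
    edist ((F.map f).toFun x) ((F.map f).toFun y) ≤
      edist ((c.ι.app j).toFun x) ((c.ι.app j).toFun y)

lemma cocone_w_apply {F : J ⥤ Met.{u}} (c : Cocone F) {j k : J} (f : j ⟶ k) (x : F.obj j) :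
    (c.ι.app k).toFun ((F.map f).toFun x) = (c.ι.app j).toFun x :=
  Met.congr_toFun (c.w f) x

lemma map_comp_apply (F : J ⥤ Met.{u}) {j k l : J} (f : j ⟶ k) (g : k ⟶ l) (x : F.obj j) :
    (F.map (f ≫ g)).toFun x = (F.map g).toFun ((F.map f).toFun x) := by
  rw [F.map_comp]; rfl

variable [IsCardinalFiltered J (Cardinal.aleph 1 : Cardinal.{u})]

variable (J) in
lemma isFiltered_of_aleph_one : IsFiltered J :=
  isFiltered_of_isCardinalFiltered J (Cardinal.aleph 1 : Cardinal.{u})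

/-- Countably many distances are attained at a common stage. -/
lemma IsTight.exists_edist_le {F : J ⥤ Met.{u}} {c : Cocone F} (hc : IsTight c) {ι : Type w}
    [Countable ι] {j : J} (x y : ι → F.obj j) : ∃ (k : J) (f : j ⟶ k), ∀ i,
    edist ((F.map f).toFun (x i)) ((F.map f).toFun (y i)) ≤
      edist ((c.ι.app j).toFun (x i)) ((c.ι.app j).toFun (y i)) := by
  choose k f hf using fun i => hc.dist j (x i) (y i)
  obtain ⟨m, a, b, hab⟩ := IsCardinalFiltered.wideSpan f (hasCardinalLT_aleph_one.{u} ι)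
  refine ⟨m, b, fun i => ?_⟩
  rw [← hab i, map_comp_apply, map_comp_apply]
  exact (Met.edist_hom_le _ _ _).trans (hf i)

/-- Countable families of points can be lifted to a stage with the same distances. -/
lemma IsTight.exists_lift {F : J ⥤ Met.{u}} {c : Cocone F} (hc : IsTight c) {ι : Type w}
    [Countable ι] (p : ι → c.pt) : ∃ (j : J) (x : ι → F.obj j),
    (∀ i, (c.ι.app j).toFun (x i) = p i) ∧ ∀ i i', edist (x i) (x i') ≤ edist (p i) (p i') := by
  choose j x hx using fun i => hc.surj (p i)
  let k := IsCardinalFiltered.max j (hasCardinalLT_aleph_one.{u} ι)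
  let y (i : ι) : F.obj k :=
    (F.map (IsCardinalFiltered.toMax j (hasCardinalLT_aleph_one.{u} ι) i)).toFun (x i)
  have hy (i : ι) : (c.ι.app k).toFun (y i) = p i := by
    rw [← hx]
    exact cocone_w_apply c _ _
  obtain ⟨l, f, hf⟩ := hc.exists_edist_le (fun q : ι × ι => y q.1) (fun q => y q.2)
  refine ⟨l, fun i => (F.map f).toFun (y i), fun i => by rw [cocone_w_apply, hy], fun i i' => ?_⟩
  simpa only [hy] using hf (i, i')

/-- Two points can be compared at a common stage. -/
lemma IsTight.exists_edist_le_of_ne {F : J ⥤ Met.{u}} {c : Cocone F} (hc : IsTight c)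
    {ι : Type w} [Countable ι] {j k : J} (x : ι → F.obj j) (y : ι → F.obj k) :
    ∃ (l : J) (f : j ⟶ l) (g : k ⟶ l), ∀ i,
    edist ((F.map f).toFun (x i)) ((F.map g).toFun (y i)) ≤
      edist ((c.ι.app j).toFun (x i)) ((c.ι.app k).toFun (y i)) := by
  have := isFiltered_of_aleph_one.{u} J
  obtain ⟨l, f, hf⟩ := hc.exists_edist_le
    (fun i => (F.map (IsFiltered.leftToMax j k)).toFun (x i))
    (fun i => (F.map (IsFiltered.rightToMax j k)).toFun (y i))
  refine ⟨l, IsFiltered.leftToMax j k ≫ f, IsFiltered.rightToMax j k ≫ f, fun i => ?_⟩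
  simpa only [map_comp_apply, cocone_w_apply] using hf i

/-- The distance in the tight vertex is attained at a common stage, and the map from that stage to
`s` is nonexpansive. This makes the descent map both well defined and nonexpansive. -/
lemma IsTight.edist_cocone_le {F : J ⥤ Met.{u}} {c : Cocone F} (hc : IsTight c) (s : Cocone F)
    {j k : J} (x : F.obj j) (y : F.obj k) :
    edist ((s.ι.app j).toFun x) ((s.ι.app k).toFun y) ≤
      edist ((c.ι.app j).toFun x) ((c.ι.app k).toFun y) := by
  obtain ⟨l, f, g, h⟩ := hc.exists_edist_le_of_ne (fun _ : Unit => x) (fun _ => y)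
  rw [← cocone_w_apply s f, ← cocone_w_apply s g]
  exact (Met.edist_hom_le _ _ _).trans (h ())

/-- The map from the vertex of a tight cocone to another cocone. -/
def IsTight.desc {F : J ⥤ Met.{u}} {c : Cocone F} (hc : IsTight c) (s : Cocone F) : c.pt ⟶ s.pt :=
  NExp.mk' (fun p => (s.ι.app (hc.surj p).choose).toFun (hc.surj p).choose_spec.choose)
    fun p q => by
      refine (hc.edist_cocone_le s _ _).trans ?_
      rw [(hc.surj p).choose_spec.choose_spec, (hc.surj q).choose_spec.choose_spec]

lemma IsTight.desc_apply {F : J ⥤ Met.{u}} {c : Cocone F} (hc : IsTight c) (s : Cocone F)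
    {j : J} (x : F.obj j) :
    (hc.desc s).toFun ((c.ι.app j).toFun x) = (s.ι.app j).toFun x := by
  refine eq_of_edist_eq_zero (le_antisymm ((hc.edist_cocone_le s _ _).trans ?_) bot_le)
  rw [(hc.surj _).choose_spec.choose_spec, edist_self]

/-- A tight cocone is a colimit. -/
def IsTight.isColimit {F : J ⥤ Met.{u}} {c : Cocone F} (hc : IsTight c) : IsColimit c where
  desc s := hc.desc s
  fac s j := Met.hom_ext fun x => hc.desc_apply s x
  uniq s m hm := Met.hom_ext fun p => by
    obtain ⟨j, x, rfl⟩ := hc.surj p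
    rw [hc.desc_apply, ← hm j]
    rfl

/-! ### Construction of countably filtered colimits -/

section Construction

variable {J : Type u} [SmallCategory J]
  (F : J ⥤ Met.{u})

/-- The distance of two points of a filtered diagram. -/
def colimDist (a b : Σ j, F.obj j) : ℝ≥0∞ :=
  ⨅ (k : J) (f : a.1 ⟶ k) (g : b.1 ⟶ k), edist ((F.map f).toFun a.2) ((F.map g).toFun b.2)

lemma colimDist_le {a b : Σ j, F.obj j} {k : J} (f : a.1 ⟶ k) (g : b.1 ⟶ k) :
    colimDist F a b ≤ edist ((F.map f).toFun a.2) ((F.map g).toFun b.2) :=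
  iInf_le_of_le k (iInf_le_of_le f (iInf_le _ g))

variable [IsCardinalFiltered J (Cardinal.aleph 1 : Cardinal.{u})]

lemma colimDist_triangle (a b c : Σ j, F.obj j) :
    colimDist F a c ≤ colimDist F a b + colimDist F b c := by
  have := isFiltered_of_aleph_one.{u} J
  conv_rhs => simp only [colimDist, ENNReal.iInf_add, ENNReal.add_iInf]
  refine le_iInf fun k => le_iInf fun f => le_iInf fun g => le_iInf fun k' => le_iInf fun f' =>
    le_iInf fun g' => ?_
  -- The two witnesses send `b` to different stages; over `l` the two legs out of `b` agree, so the
  -- image of `b` can serve as midpoint.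
  obtain ⟨l, p, q, h⟩ := IsFiltered.span g' f
  refine (colimDist_le F (f' ≫ p) (g ≫ q)).trans ?_
  refine (edist_triangle _ ((F.map (g' ≫ p)).toFun b.2) _).trans (add_le_add ?_ ?_)
  · rw [map_comp_apply, map_comp_apply]
    exact Met.edist_hom_le _ _ _
  · rw [h, map_comp_apply, map_comp_apply]
    exact Met.edist_hom_le _ _ _

/-- The points of a filtered diagram, as a pseudometric space. -/
def Points : Type u := Σ j, F.obj j

instance : PseudoEMetricSpace (Points F) where
  edist := colimDist F
  edist_self a := le_antisymm ((colimDist_le F (𝟙 a.1) (𝟙 a.1)).trans (by simp)) bot_le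
  edist_comm a b := by
    apply le_antisymm <;>
    exact le_iInf fun k => le_iInf fun f => le_iInf fun g =>
      (colimDist_le F g f).trans (edist_comm _ _).le
  edist_triangle := colimDist_triangle F

/-- The colimit of a filtered diagram of metric spaces. -/
def metColim : Met.{u} := ⟨SeparationQuotient (Points F)⟩

/-- The class of a point in the colimit. -/
def colimMk {j : J} (x : F.obj j) : metColim F := SeparationQuotient.mk (⟨j, x⟩ : Points F)

lemma edist_colimMk {j k : J} (x : F.obj j) (y : F.obj k) :
    edist (colimMk F x) (colimMk F y) = colimDist F ⟨j, x⟩ ⟨k, y⟩ :=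
  SeparationQuotient.edist_mk (X := Points F) ⟨j, x⟩ ⟨k, y⟩

lemma colimMk_surj (p : metColim F) : ∃ j, ∃ x : F.obj j, colimMk F x = p := by
  obtain ⟨⟨j, x⟩, h⟩ := SeparationQuotient.surjective_mk p
  exact ⟨j, x, h⟩

/-- The colimit cocone of a filtered diagram of metric spaces. -/
def colimCocone : Cocone F where
  pt := metColim F
  ι :=
    { app j := NExp.mk' (fun x => colimMk F x) fun x y => by
        rw [edist_colimMk]
        exact (colimDist_le F (𝟙 j) (𝟙 j)).trans (by simp)
      naturality j k f := Met.hom_ext fun x => by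
        change colimMk F ((F.map f).toFun x) = colimMk F x
        refine eq_of_edist_eq_zero (le_antisymm ?_ bot_le)
        rw [edist_colimMk]
        refine (colimDist_le F (𝟙 k) f).trans ?_
        simp }

/-- Countable filteredness, not just filteredness, enters here: a stage above a whole minimizing
sequence attains the infimum. -/
lemma colimCocone_isTight : IsTight (colimCocone F) where
  surj p := colimMk_surj F p
  dist j x y := by
    have := isFiltered_of_aleph_one.{u} J
    change ∃ (k : J) (f : j ⟶ k), edist ((F.map f).toFun x) ((F.map f).toFun y) ≤
      edist (colimMk F x) (colimMk F y)
    rw [edist_colimMk]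
    let S : Set ℝ≥0∞ := Set.range fun p : Σ k, j ⟶ k =>
      edist ((F.map p.2).toFun x) ((F.map p.2).toFun y)
    have hS : S.Nonempty := ⟨_, ⟨j, 𝟙 j⟩, rfl⟩
    obtain ⟨u, -, hu, huS⟩ := exists_seq_tendsto_sInf hS (OrderBot.bddBelow S)
    choose p hp using huS
    obtain ⟨m, a, b, hab⟩ := IsCardinalFiltered.wideSpan (fun n => (p n).2)
      (hasCardinalLT_aleph_one.{u} ℕ)
    refine ⟨m, b, (ge_of_tendsto' hu fun n => ?_).trans ?_⟩
    · rw [← hp n, ← hab n, map_comp_apply, map_comp_apply]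
      exact Met.edist_hom_le _ _ _
    -- A witness of the colimit distance may use different legs `f` and `g` out of `j`; coequalizing
    -- them yields a member of `S` that is no larger.
    · refine le_iInf fun k => le_iInf fun f => le_iInf fun g => ?_
      have hle : sInf S ≤ edist ((F.map (f ≫ IsFiltered.coeqHom f g)).toFun x)
          ((F.map (f ≫ IsFiltered.coeqHom f g)).toFun y) :=
        sInf_le ⟨⟨_, f ≫ IsFiltered.coeqHom f g⟩, rfl⟩
      refine hle.trans ?_
      conv_lhs => rw [map_comp_apply, IsFiltered.coeq_condition, map_comp_apply]
      exact Met.edist_hom_le _ _ _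

variable {F} in
/-- Colimit cocones of countably filtered diagrams are tight. -/
lemma isTight_of_isColimit {c : Cocone F} (hc : IsColimit c) : IsTight c := by
  let e := hc.coconePointUniqueUpToIso (colimCocone_isTight F).isColimit
  have he (j : J) (x : F.obj j) : e.hom.toFun ((c.ι.app j).toFun x) = colimMk F x :=
    Met.congr_toFun (hc.comp_coconePointUniqueUpToIso_hom (colimCocone_isTight F).isColimit j) x
  have hinv (p : c.pt) : e.inv.toFun (e.hom.toFun p) = p := Met.congr_toFun e.hom_inv_id p
  refine ⟨fun p => ?_, fun j x y => ?_⟩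
  · obtain ⟨j, x, h⟩ := colimMk_surj F (e.hom.toFun p)
    refine ⟨j, x, ?_⟩
    rw [← hinv p, ← h, ← he, hinv]
  · obtain ⟨k, f, h⟩ := (colimCocone_isTight F).dist j x y
    refine ⟨k, f, h.trans ?_⟩
    change edist (colimMk F x) (colimMk F y) ≤ _
    rw [← he, ← he]
    exact Met.edist_hom_le _ _ _

end Construction

end MetEq

namespace MetEq

open Limits

/-! ### Presentations of countable spaces -/

/-- Enumerate the space by an initial segment of `ℕ` and pull back the metric; thus arities stand
for all countable spaces. -/
lemma exists_metricCardinal (A : Type u) [EMetricSpace A] [Countable A] :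
    ∃ (C : MetricCardinal) (e : C ≃ A), ∀ i j, edist (e i) (e j) = edist i j := by
  obtain ⟨n, ⟨e⟩⟩ : ∃ n : ℕ∞, Nonempty ({k : ℕ // (k : ℕ∞) < n} ≃ A) := by
    rcases finite_or_infinite A with h | h
    · obtain ⟨n, ⟨e⟩⟩ := Finite.exists_equiv_fin A
      refine ⟨n, ⟨(Equiv.subtypeEquivRight fun k => ?_).trans (Fin.equivSubtype.symm.trans e.symm)⟩⟩
      exact Nat.cast_lt
    · obtain ⟨e⟩ := nonempty_equiv_of_countable (α := ℕ) (β := A)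
      refine ⟨⊤, ⟨(Equiv.subtypeUnivEquiv fun k => ?_).trans e⟩⟩
      exact ENat.natCast_lt_top k
  exact ⟨⟨n, EMetricSpace.induced e e.injective inferInstance⟩, e, fun i j => rfl⟩

/-! ### Interpretation of preterms -/

namespace SigModel

variable {Ω : Signature.{u}} (M : SigModel Ω)

lemma mem_interp_var {Γ : Context ℕ} {x : ℕ} {v : M.Assignment Γ → M.space} :
    v ∈ M.interp Γ (.var x) ↔ v = fun α => α.1 x :=
  Part.mem_some_iff

lemma mem_interp_op {Γ : Context ℕ} {f : Ω.Op} {t : Ω.arity f → Preterm Ω ℕ}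
    {w : M.Assignment Γ → M.space} :
    w ∈ M.interp Γ (.op f t) ↔ ∃ (v : Ω.arity f → M.Assignment Γ → M.space)
      (_ : ∀ i, v i ∈ M.interp Γ (t i)) (h : ∀ α i j, edist (v i α) (v j α) ≤ edist i j),
      w = fun α => (M.op f).toFun (NExp.mk' (fun i => v i α) (h α)) := by
  constructor
  · rintro ⟨⟨h₁, h₂⟩, rfl⟩
    exact ⟨fun i => (M.interp Γ (t i)).get (h₁ i), fun i => Part.get_mem _,
      fun α i j => (supDist_le_iff _ _ _).1 (h₂ i j) α, rfl⟩
  · rintro ⟨v, hv, h, rfl⟩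
    choose hd hg using hv
    obtain rfl : (fun i => (M.interp Γ (t i)).get (hd i)) = v := funext hg
    exact ⟨⟨hd, fun i j => (supDist_le_iff _ _ _).2 fun α => h α i j⟩, rfl⟩

lemma satisfies_ok_iff {Γ : Context ℕ} {t : Preterm Ω ℕ} :
    M.Satisfies (.ok Γ t) ↔ ∃ v, v ∈ M.interp Γ t :=
  Part.dom_iff_mem

lemma satisfies_eq_iff {Γ : Context ℕ} {s t : Preterm Ω ℕ} {ε : ℝ≥0} :
    M.Satisfies (.eq Γ s ε t) ↔ ∃ v ∈ M.interp Γ s, ∃ w ∈ M.interp Γ t,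
      ∀ α, edist (v α) (w α) ≤ ε := by
  constructor
  · rintro ⟨hs, ht, h⟩
    exact ⟨_, Part.get_mem hs, _, Part.get_mem ht, (supDist_le_iff _ _ _).1 h⟩
  · rintro ⟨_, ⟨hs, rfl⟩, _, ⟨ht, rfl⟩, h⟩
    exact ⟨hs, ht, (supDist_le_iff _ _ _).2 h⟩

/-- Interpreting `σ` turns assignments of `Γ` into assignments of `Δ`; a distance bound valid for
all of the latter holds in particular for these, so definedness carries over. -/
lemma mem_interp_subst {Γ Δ : Context ℕ} {σ : ℕ → Preterm Ω ℕ}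
    {v : ℕ → M.Assignment Γ → M.space} (hv : ∀ x, v x ∈ M.interp Γ (σ x))
    (hΔ : ∀ α, Δ.Sat fun x => v x α) {s : Preterm Ω ℕ} {w : M.Assignment Δ → M.space}
    (hw : w ∈ M.interp Δ s) :
    (fun α => w ⟨fun x => v x α, hΔ α⟩) ∈ M.interp Γ (s.subst σ) := by
  induction s generalizing w with
  | var x =>
    rw [mem_interp_var] at hw
    subst hw
    exact hv x
  | op f t ih =>
    obtain ⟨u, hu, h, rfl⟩ := M.mem_interp_op.1 hw
    exact M.mem_interp_op.2 ⟨fun i α => u i ⟨fun x => v x α, hΔ α⟩, fun i => ih i (hu i),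
      fun α => h _, rfl⟩

/-- The rules record only finite distances; an infinite one imposes nothing. -/
lemma edist_le_of_forall {M : Type v} [EDist M] {ι : Type w} [EDist ι] {v : ι → M}
    (h : ∀ (i j : ι) (δ : ℝ≥0), edist i j = δ → edist (v i) (v j) ≤ δ) (i j : ι) :
    edist (v i) (v j) ≤ edist i j := by
  by_cases hij : edist i j = ⊤
  · rw [hij]
    exact le_top
  · rw [← ENNReal.coe_toNNReal hij]
    exact h i j _ (ENNReal.coe_toNNReal hij).symm

/-- Deduction is sound. -/
lemma satisfies_of_deducible {S : Set (Judgment Ω)} (hS : ∀ J ∈ S, M.Satisfies J)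
    {J : Judgment Ω} (hJ : Deducible S J) : M.Satisfies J := by
  induction hJ with
  | ax h => exact hS _ h
  | var Γ x => exact trivial
  | assum Γ x ε y h =>
    exact M.satisfies_eq_iff.2 ⟨_, M.mem_interp_var.2 rfl, _, M.mem_interp_var.2 rfl,
      fun α => α.2 _ _ _ h⟩
  | refl Γ t _ ih =>
    obtain ⟨v, hv⟩ := M.satisfies_ok_iff.1 ih
    exact M.satisfies_eq_iff.2 ⟨v, hv, v, hv, by simp⟩
  | symm Γ s t ε _ ih =>
    obtain ⟨v, hv, w, hw, h⟩ := M.satisfies_eq_iff.1 ih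
    exact M.satisfies_eq_iff.2 ⟨w, hw, v, hv, fun α => by rw [edist_comm]; exact h α⟩
  | triang Γ s t r ε ε' _ _ ih₁ ih₂ =>
    obtain ⟨v, hv, w, hw, h⟩ := M.satisfies_eq_iff.1 ih₁
    obtain ⟨w', hw', u, hu, h'⟩ := M.satisfies_eq_iff.1 ih₂
    obtain rfl := Part.mem_unique hw hw'
    refine M.satisfies_eq_iff.2 ⟨v, hv, u, hu, fun α => (edist_triangle _ (w α) _).trans ?_⟩
    rw [ENNReal.coe_add]
    exact add_le_add (h α) (h' α)
  | max Γ s t ε ε' hε _ ih =>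
    obtain ⟨v, hv, w, hw, h⟩ := M.satisfies_eq_iff.1 ih
    exact M.satisfies_eq_iff.2 ⟨v, hv, w, hw, fun α =>
      (h α).trans (ENNReal.coe_le_coe.2 hε.le)⟩
  | cont Γ s t ε _ ih =>
    -- Any larger bound would do in place of `ε + 1`: only the definedness of both sides is
    -- extracted.
    obtain ⟨v, hv, w, hw, -⟩ := M.satisfies_eq_iff.1 (ih (ε + 1) (by simp))
    refine M.satisfies_eq_iff.2 ⟨v, hv, w, hw, fun α => ?_⟩
    refine ENNReal.le_of_forall_pos_le_add fun δ hδ _ => ?_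
    obtain ⟨v', hv', w', hw', h⟩ := M.satisfies_eq_iff.1 (ih (ε + δ) (by simpa using hδ))
    obtain rfl := Part.mem_unique hv hv'
    obtain rfl := Part.mem_unique hw hw'
    exact_mod_cast h α
  | nexp Γ f s t ε _ _ _ ih₁ ih₂ ih₃ =>
    choose v hv w hw h using fun i => M.satisfies_eq_iff.1 (ih₃ i)
    refine M.satisfies_eq_iff.2 ⟨_, M.mem_interp_op.2 ⟨v, hv, fun α => edist_le_of_forall
      fun i j δ hδ => ?_, rfl⟩, _, M.mem_interp_op.2 ⟨w, hw, fun α => edist_le_of_forall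
      fun i j δ hδ => ?_, rfl⟩, fun α => ((M.op f).edist_le _ _).trans ?_⟩
    · obtain ⟨v', hv', w', hw', h⟩ := M.satisfies_eq_iff.1 (ih₁ i j δ hδ)
      rw [Part.mem_unique (hv i) hv', Part.mem_unique (hv j) hw']
      exact h α
    · obtain ⟨v', hv', w', hw', h⟩ := M.satisfies_eq_iff.1 (ih₂ i j δ hδ)
      rw [Part.mem_unique (hw i) hv', Part.mem_unique (hw j) hw']
      exact h α
    · exact (NExp.edist_le_iff _ _ _).2 fun i => h i α
  | subst Γ Δ σ s t ε _ _ _ ih₁ ih₂ ih₃ =>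
    choose v hv using fun x => M.satisfies_ok_iff.1 (ih₁ x)
    have hΔ (α : M.Assignment Γ) : Δ.Sat fun x => v x α := by
      intro x δ y hxy
      obtain ⟨v', hv', w', hw', h⟩ := M.satisfies_eq_iff.1 (ih₂ x δ y hxy)
      dsimp only
      rw [Part.mem_unique (hv x) hv', Part.mem_unique (hv y) hw']
      exact h α
    obtain ⟨w, hw, w', hw', h⟩ := M.satisfies_eq_iff.1 ih₃
    exact M.satisfies_eq_iff.2 ⟨_, M.mem_interp_subst hv hΔ hw, _, M.mem_interp_subst hv hΔ hw',
      fun α => h _⟩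
  | app Γ f t _ _ ih₁ ih₂ =>
    choose v hv using fun i => M.satisfies_ok_iff.1 (ih₁ i)
    refine M.satisfies_ok_iff.2 ⟨_, M.mem_interp_op.2 ⟨v, hv, fun α => edist_le_of_forall
      fun i j δ hδ => ?_, rfl⟩⟩
    obtain ⟨v', hv', w', hw', h⟩ := M.satisfies_eq_iff.1 (ih₂ i j δ hδ)
    rw [Part.mem_unique (hv i) hv', Part.mem_unique (hv j) hw']
    exact h α

end SigModel

/-! ### Examples of metric equational theories -/

lemma Deducible.of_deducible {Ω : Signature.{u}} {S S' : Set (Judgment Ω)}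
    (h : ∀ J ∈ S, Deducible S' J) {J : Judgment Ω} (hJ : Deducible S J) : Deducible S' J := by
  induction hJ with
  | ax hJ => exact h _ hJ
  | var Γ x => exact .var Γ x
  | assum Γ x ε y h => exact .assum Γ x ε y h
  | refl Γ t _ ih => exact .refl Γ t ih
  | symm Γ s t ε _ ih => exact .symm Γ s t ε ih
  | triang Γ s t r ε ε' _ _ ih₁ ih₂ => exact .triang Γ s t r ε ε' ih₁ ih₂
  | max Γ s t ε ε' hε _ ih => exact .max Γ s t ε ε' hε ih
  | cont Γ s t ε _ ih => exact .cont Γ s t ε ih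
  | nexp Γ f s t ε _ _ _ ih₁ ih₂ ih₃ => exact .nexp Γ f s t ε ih₁ ih₂ ih₃
  | subst Γ Δ σ s t ε _ _ _ ih₁ ih₂ ih₃ => exact .subst Γ Δ σ s t ε ih₁ ih₂ ih₃
  | app Γ f t _ _ ih₁ ih₂ => exact .app Γ f t ih₁ ih₂

/-- Substitution in well-formedness judgments is admissible if there are no such axioms. -/
lemma Deducible.ok_subst {Ω : Signature.{u}} {S : Set (Judgment Ω)}
    (hS : ∀ Γ t, .ok Γ t ∉ S) {Γ Δ : Context ℕ} {σ : ℕ → Preterm Ω ℕ} {s : Preterm Ω ℕ}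
    (h₁ : ∀ x, Deducible S (.ok Γ (σ x)))
    (h₂ : ∀ x δ y, (x, δ, y) ∈ Δ.eqs → Deducible S (.eq Γ (σ x) δ (σ y)))
    (hs : Deducible S (.ok Δ s)) : Deducible S (.ok Γ (s.subst σ)) := by
  induction s with
  | var x => exact h₁ x
  | op f t ih =>
    -- Without `ok` axioms, well-formedness of a compound term can only come from `app`; its
    -- distance premises are transported by the rule `subst` for equations.
    cases hs with
    | ax h => exact absurd h (hS _ _)
    | app _ _ _ h h' =>
      exact .app _ _ _ (fun i => ih i (h i)) fun i j δ hδ =>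
        .subst _ _ _ _ _ _ h₁ h₂ (h' i j δ hδ)

/-- If the axioms are equations between well-formed terms, then so are all deducible equations. -/
lemma Deducible.wellFormed {Ω : Signature.{u}} {S : Set (Judgment Ω)}
    (hS : ∀ Γ t, .ok Γ t ∉ S)
    (hS' : ∀ Γ s ε t, .eq Γ s ε t ∈ S → Deducible S (.ok Γ s) ∧ Deducible S (.ok Γ t))
    {Γ : Context ℕ} {s t : Preterm Ω ℕ} {ε : ℝ≥0} (h : Deducible S (.eq Γ s ε t)) :
    Deducible S (.ok Γ s) ∧ Deducible S (.ok Γ t) := by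
  generalize hJ : Judgment.eq Γ s ε t = J at h
  induction h generalizing Γ s ε t with
  | ax h => subst hJ; exact hS' _ _ _ _ h
  | var Γ x => cases hJ
  | assum Γ x ε y h => cases hJ; exact ⟨.var _ _, .var _ _⟩
  | refl Γ t h => cases hJ; exact ⟨h, h⟩
  | symm Γ s t ε _ ih => cases hJ; exact (ih rfl).symm
  | triang Γ s t r ε ε' _ _ ih₁ ih₂ => cases hJ; exact ⟨(ih₁ rfl).1, (ih₂ rfl).2⟩
  | max Γ s t ε ε' hε _ ih => cases hJ; exact ih rfl
  | cont Γ s t ε _ ih => cases hJ; exact ih (ε + 1) (by simp) rfl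
  | nexp Γ f s t ε h₁ h₂ h₃ ih₁ ih₂ ih₃ =>
    cases hJ
    exact ⟨.app _ _ _ (fun i => (ih₃ i rfl).1) h₁, .app _ _ _ (fun i => (ih₃ i rfl).2) h₂⟩
  | subst Γ Δ σ s t ε h₁ h₂ h₃ ih₁ ih₂ ih₃ =>
    cases hJ
    exact ⟨ok_subst hS h₁ h₂ (ih₃ rfl).1, ok_subst hS h₁ h₂ (ih₃ rfl).2⟩
  | app Γ f t _ _ ih₁ ih₂ => cases hJ

/-- A theory generated by equations between well-formed terms is a metric equational theory. -/
lemma isMET_of_axioms {Ω : Signature.{u}} {S : Set (Judgment Ω)}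
    (hS : ∀ Γ t, .ok Γ t ∉ S)
    (hS' : ∀ Γ s ε t, .eq Γ s ε t ∈ S → Deducible S (.ok Γ s) ∧ Deducible S (.ok Γ t)) :
    IsMET {J | Deducible S J} := by
  refine ⟨fun Γ s ε t h => Deducible.wellFormed hS hS' h, Set.Subset.antisymm (fun J hJ => ?_)
    fun J hJ => ?_⟩
  · refine hJ.of_deducible fun J h => ?_
    cases J with
    | ok Γ t => exact absurd h (hS _ _)
    | eq Γ s ε t => exact .ax ⟨.ax h, Γ, s, ε, t, rfl⟩
  · exact Deducible.of_deducible (fun J h => h.1) hJ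

/-- The judgments that hold in a class of models form a metric equational theory. -/
lemma isMET_of_models {Ω : Signature.{u}} (K : SigModel Ω → Prop) :
    IsMET {J | ∀ M, K M → M.Satisfies J} := by
  refine ⟨fun Γ s ε t h => ⟨fun M hM => (h M hM).fst, fun M hM => (h M hM).snd.fst⟩,
    Set.Subset.antisymm (fun J hJ => ?_) fun J hJ M hM =>
      M.satisfies_of_deducible (fun J h => h.1 M hM) hJ⟩
  have hrefl (J : Judgment Ω) (hJ : ∀ M, K M → M.Satisfies J) (h : ∃ Γ s ε t, J = .eq Γ s ε t) :
      Deducible (equational {J | ∀ M, K M → M.Satisfies J}) J := .ax ⟨hJ, h⟩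
  cases J with
  | eq Γ s ε t => exact hrefl _ hJ ⟨Γ, s, ε, t, rfl⟩
  | ok Γ t =>
    induction t with
    | var x => exact .var _ _
    | op f t ih =>
      -- The distance premises of `app` are themselves equations valid in the whole class, hence
      -- available as axioms.
      refine .app _ _ _ (fun i => ih i fun M hM => (hJ M hM).fst i) fun i j δ hδ =>
        hrefl _ (fun M hM => ?_) ⟨_, _, _, _, rfl⟩
      obtain ⟨h₁, h₂⟩ := hJ M hM
      exact ⟨h₁ i, h₁ j, (h₂ i j).trans hδ.le⟩

/-! ### Signatures indexed by metric cardinals -/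

/-- The signature with operations of arity `C` given by the elements of `P C`. -/
@[reducible]
def opSignature (P : MetricCardinal → Type u) : Signature.{u} where
  Op := Σ C, P C
  arity f := f.1

section

variable {P : MetricCardinal → Type u}

/-- The preterm `[f](x_0, x_1, …)`. -/
def opVars {C : MetricCardinal} (f : P C) : Preterm (opSignature P) ℕ :=
  .op (Ω := opSignature P) ⟨C, f⟩ fun i => .var i.val

variable (M : SigModel (opSignature P))

/-- The operation given by an element of `P C`. -/
def SigModel.ap {C : MetricCardinal} (f : P C) : NExp (NExp C M.space) M.space := M.op ⟨C, f⟩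

variable {M}

/-- The nonexpansive map given by an assignment. -/
def SigModel.Assignment.restrict {C : MetricCardinal} (α : M.Assignment C.context) :
    NExp C M.space :=
  NExp.mk' (fun i => α.1 i.val) <| SigModel.edist_le_of_forall fun i j δ hδ =>
    α.2 _ _ _ ⟨⟨(i, j), by simp [hδ]⟩, by simp [hδ]⟩

/-- An assignment which extends a nonexpansive map. -/
def SigModel.Assignment.extend {C : MetricCardinal} (m : NExp C M.space) (a : M.space) :
    M.Assignment C.context :=
  -- The context constrains only the variables below `C.card`; the others get the arbitrary value
  -- `a`.
  ⟨fun k => open Classical in if h : (k : ℕ∞) < C.card then m.toFun ⟨k, h⟩ else a, by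
    rintro _ _ _ ⟨⟨⟨i, j⟩, hp⟩, h⟩
    obtain ⟨rfl, rfl, rfl⟩ := by simpa using h
    dsimp only
    rw [dif_pos i.2, dif_pos j.2, ENNReal.coe_toNNReal hp]
    exact m.edist_le _ _⟩

lemma SigModel.Assignment.extend_apply {C : MetricCardinal} (m : NExp C M.space) (a : M.space)
    (i : C) : (extend m a).1 i.val = m.toFun i := dif_pos i.2

lemma SigModel.Assignment.restrict_extend {C : MetricCardinal} (m : NExp C M.space)
    (a : M.space) : (extend m a).restrict = m := NExp.ext_apply fun i => extend_apply m a i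

variable (M)

/-- The context lists the finite distances of `C`, so the term is defined in every model and depends
only on the restriction of the assignment to `C`. -/
lemma SigModel.mem_interp_opVars {C : MetricCardinal} (f : P C) :
    (fun α => (M.ap f).toFun α.restrict) ∈ M.interp C.context (opVars f) :=
  M.mem_interp_op.2 ⟨fun i α => α.1 i.val, fun _ => M.mem_interp_var.2 rfl,
    fun α => α.restrict.edist_le, rfl⟩

/-- With the next two lemmas, this turns the axiom schemes into statements about operations, free of
assignments. They serve both for Lawvere theories and for the theory of a monad. -/
lemma SigModel.satisfies_dist_iff {C : MetricCardinal} (f f' : P C) (ε : ℝ≥0) :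
    M.Satisfies (.eq C.context (opVars f) ε (opVars f')) ↔
      ∀ m, edist ((M.ap f).toFun m) ((M.ap f').toFun m) ≤ ε := by
  rw [satisfies_eq_iff]
  constructor
  · rintro ⟨v, hv, w, hw, h⟩ m
    obtain rfl := Part.mem_unique hv (M.mem_interp_opVars f)
    obtain rfl := Part.mem_unique hw (M.mem_interp_opVars f')
    -- The value of the operation itself is the default point, so the argument also covers an empty
    -- `C`.
    simpa only [Assignment.restrict_extend] using h (.extend m ((M.ap f).toFun m))
  · exact fun h => ⟨_, M.mem_interp_opVars f, _, M.mem_interp_opVars f', fun α => h _⟩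

lemma SigModel.satisfies_proj_iff {C : MetricCardinal} (f : P C) (i : C) :
    M.Satisfies (.eq C.context (opVars f) 0 (.var i.val)) ↔
      ∀ m, (M.ap f).toFun m = m.toFun i := by
  rw [satisfies_eq_iff]
  constructor
  · rintro ⟨v, hv, w, hw, h⟩ m
    obtain rfl := Part.mem_unique hv (M.mem_interp_opVars f)
    obtain rfl := M.mem_interp_var.1 hw
    have := h (.extend m ((M.ap f).toFun m))
    dsimp only at this
    rw [Assignment.restrict_extend, Assignment.extend_apply] at this
    exact eq_of_edist_eq_zero (le_antisymm this bot_le)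
  · refine fun h => ⟨_, M.mem_interp_opVars f, _, M.mem_interp_var.2 rfl, fun α => ?_⟩
    rw [h]
    exact (edist_self _).le

/-- Satisfaction includes definedness of the nested term, hence the existential over the distance
bound. -/
lemma SigModel.satisfies_comp_iff {C D : MetricCardinal} (f : P C) (g : C → P D) (k : P D) :
    M.Satisfies (.eq D.context (.op (Ω := opSignature P) ⟨C, f⟩ fun i => opVars (g i)) 0
      (opVars k)) ↔
    ∃ h : ∀ m i j, edist ((M.ap (g i)).toFun m) ((M.ap (g j)).toFun m) ≤ edist i j,
      ∀ m, (M.ap f).toFun (NExp.mk' (fun i => (M.ap (g i)).toFun m) (h m)) = (M.ap k).toFun m := by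
  rw [satisfies_eq_iff]
  constructor
  · rintro ⟨v, hv, w, hw, h⟩
    obtain rfl := Part.mem_unique hw (M.mem_interp_opVars k)
    obtain ⟨u, hu, h', rfl⟩ := M.mem_interp_op.1 hv
    obtain rfl : u = fun i α => (M.ap (g i)).toFun α.restrict :=
      funext fun i => Part.mem_unique (hu i) (M.mem_interp_opVars (g i))
    refine ⟨fun m i j => ?_, fun m => ?_⟩
    · have := h' (.extend m ((M.ap k).toFun m)) i j
      dsimp only at this
      rwa [Assignment.restrict_extend] at this
    · have := h (.extend m ((M.ap k).toFun m))
      have := eq_of_edist_eq_zero (le_antisymm this bot_le)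
      simp only [Assignment.restrict_extend] at this
      exact this
  · rintro ⟨h, h'⟩
    refine ⟨_, M.mem_interp_op.2 ⟨fun i α => (M.ap (g i)).toFun α.restrict,
      fun i => M.mem_interp_opVars (g i), fun α => h _, rfl⟩, _, M.mem_interp_opVars k,
      fun α => ?_⟩
    refine le_of_eq_of_le ?_ bot_le
    rw [← h']
    exact edist_self _

end

end MetEq

namespace MetEq

open Limits

/-! ### Powers -/

section

variable {C : Type w} [MetCategory.{v} C]

lemma edist_comp_left_le {X Y Z : C} (f : X ⟶ Y) (g g' : Y ⟶ Z) :
    edist (f ≫ g) (f ≫ g') ≤ edist g g' := by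
  simpa using MetCategory.edist_comp_le f f g g'

lemma edist_comp_right_le {X Y Z : C} (f f' : X ⟶ Y) (g : Y ⟶ Z) :
    edist (f ≫ g) (f' ≫ g) ≤ edist f f' := by
  simpa using MetCategory.edist_comp_le f f' g g

lemma IsPower.edist_le {V : Type u} [EMetricSpace V] {X P : C} {l : V → (P ⟶ X)}
    (hl : IsPower V X P l) {A : C} {h h' : A ⟶ P} {r : ℝ≥0∞}
    (H : ∀ a, edist (h ≫ l a) (h' ≫ l a) ≤ r) : edist h h' ≤ r := by
  rw [hl.isometry]
  exact (supDist_le_iff _ _ _).2 H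

lemma IsPower.hom_ext {V : Type u} [EMetricSpace V] {X P : C} {l : V → (P ⟶ X)}
    (hl : IsPower V X P l) {A : C} {h h' : A ⟶ P} (H : ∀ a, h ≫ l a = h' ≫ l a) : h = h' :=
  eq_of_edist_eq_zero (le_antisymm (hl.edist_le fun a => by rw [H, edist_self]) bot_le)

/-- Two spaces, with the sum of the metrics on their product. -/
structure TensorProd (V : Type v) (W : Type w) where
  fst : V
  snd : W

instance {V : Type v} {W : Type w} [EMetricSpace V] [EMetricSpace W] :
    EMetricSpace (TensorProd V W) where
  edist p q := edist p.1 q.1 + edist p.2 q.2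
  edist_self p := by simp
  edist_comm p q := by simp [edist_comm]
  edist_triangle p q r := by
    refine (add_le_add (edist_triangle p.1 q.1 r.1) (edist_triangle p.2 q.2 r.2)).trans ?_
    rw [add_add_add_comm]
  eq_of_edist_eq_zero {p q} h := by
    obtain ⟨h₁, h₂⟩ := add_eq_zero.1 h
    cases p
    cases q
    rw [TensorProd.mk.injEq]
    exact ⟨eq_of_edist_eq_zero h₁, eq_of_edist_eq_zero h₂⟩

lemma TensorProd.edist_def {V : Type v} {W : Type w} [EMetricSpace V] [EMetricSpace W]
    (p q : TensorProd V W) : edist p q = edist p.1 q.1 + edist p.2 q.2 := rfl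

instance {V : Type v} {W : Type w} [Countable V] [Countable W] : Countable (TensorProd V W) :=
  Function.Injective.countable (f := fun p : TensorProd V W => (p.fst, p.snd)) fun p q h => by
    cases p
    cases q
    simpa using h

/-- A power of a power is a power by the tensor product. -/
lemma IsPower.comp {V W : Type u} [EMetricSpace V] [EMetricSpace W] {X Y P : C}
    {l : V → (P ⟶ Y)} {l' : W → (Y ⟶ X)} (hl : IsPower V Y P l) (hl' : IsPower W X Y l') :
    IsPower (TensorProd V W) X P fun q => l q.fst ≫ l' q.snd where
  nonexp := (lipschitz_one_iff _).2 fun p q => (MetCategory.edist_comp_le _ _ _ _).trans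
    (add_le_add ((lipschitz_one_iff _).1 hl.nonexp _ _) ((lipschitz_one_iff _).1 hl'.nonexp _ _))
  isometry A h h' := by
    apply le_antisymm
    · refine hl.edist_le fun v => hl'.edist_le fun w => ?_
      rw [Category.assoc, Category.assoc]
      exact le_iSup (fun q : TensorProd V W =>
        edist (h ≫ l q.fst ≫ l' q.snd) (h' ≫ l q.fst ≫ l' q.snd)) ⟨v, w⟩
    · exact (supDist_le_iff _ _ _).2 fun q => edist_comp_right_le _ _ _
  lift A g hg := by
    rw [lipschitz_one_iff] at hg
    choose k hk using fun v => hl'.lift A (fun w => g ⟨v, w⟩) ((lipschitz_one_iff _).2 fun w w' =>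
      (hg _ _).trans (by simp [TensorProd.edist_def]))
    obtain ⟨h, hh⟩ := hl.lift A k ((lipschitz_one_iff _).2 fun v v' => hl'.edist_le fun w => by
      rw [hk, hk]
      exact (hg _ _).trans (by simp [TensorProd.edist_def]))
    exact ⟨h, fun q => by rw [← Category.assoc, hh, hk]⟩

lemma isPower_punit (X : C) : IsPower PUnit.{u + 1} X X fun _ => 𝟙 X where
  nonexp := LipschitzWith.const' _
  isometry A h h' := by simp [supDist]
  lift A g _ := ⟨g ⟨⟩, by simp⟩

end

/-! ### Powers of metric spaces, tested on points -/

section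

variable {V : Type u} [EMetricSpace V] {X P : Met.{u}} {l : V → (P ⟶ X)}

/-- A point of a metric space as a map from the one-point space. -/
def Met.pt {X : Met.{u}} (x : X) : (⟨PUnit⟩ : Met.{u}) ⟶ X := ⟨fun _ => x, LipschitzWith.const' x⟩

lemma Met.edist_pt {X : Met.{u}} (x y : X) : edist (Met.pt x) (Met.pt y) = edist x y := by
  change (⨆ _ : PUnit, edist x y) = _
  exact iSup_const

/-- Points are maps from the one-point space, so the isometry condition applies to that object. -/
lemma IsPower.edist_apply_le (hl : IsPower V X P l) {p q : P} {r : ℝ≥0∞}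
    (h : ∀ a, edist ((l a).toFun p) ((l a).toFun q) ≤ r) : edist p q ≤ r := by
  rw [← Met.edist_pt]
  refine hl.edist_le fun a => ?_
  change edist (Met.pt ((l a).toFun p)) (Met.pt ((l a).toFun q)) ≤ r
  rw [Met.edist_pt]
  exact h a

lemma IsPower.apply_ext (hl : IsPower V X P l) {p q : P}
    (h : ∀ a, (l a).toFun p = (l a).toFun q) : p = q :=
  eq_of_edist_eq_zero (le_antisymm (hl.edist_apply_le fun a => by rw [h, edist_self]) bot_le)

lemma IsPower.exists_point (hl : IsPower V X P l) (m : V → X)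
    (hm : ∀ a b, edist (m a) (m b) ≤ edist a b) : ∃ p : P, ∀ a, (l a).toFun p = m a := by
  obtain ⟨h, hh⟩ := hl.lift ⟨PUnit⟩ (fun a => Met.pt (m a)) ((lipschitz_one_iff _).2 fun a b => by
    rw [Met.edist_pt]
    exact hm a b)
  exact ⟨h.toFun ⟨⟩, fun a => Met.congr_toFun (hh a) ⟨⟩⟩

/-- Since the projections control distances, the pointwise lift of a family of maps is automatically
nonexpansive. -/
lemma Met.isPower_of (h₁ : ∀ a b, edist (l a) (l b) ≤ edist a b)
    (h₂ : ∀ (p q : P) (r : ℝ≥0∞), (∀ a, edist ((l a).toFun p) ((l a).toFun q) ≤ r) →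
      edist p q ≤ r)
    (h₃ : ∀ m : V → X, (∀ a b, edist (m a) (m b) ≤ edist a b) →
      ∃ p : P, ∀ a, (l a).toFun p = m a) : IsPower V X P l where
  nonexp := (lipschitz_one_iff _).2 h₁
  isometry A h h' := by
    apply le_antisymm
    · refine (NExp.edist_le_iff _ _ _).2 fun x => h₂ _ _ _ fun a => ?_
      exact (NExp.edist_apply_le (h ≫ l a) (h' ≫ l a) x).trans
        (le_iSup (fun a => edist (h ≫ l a) (h' ≫ l a)) a)
    · exact (supDist_le_iff _ _ _).2 fun a => edist_comp_right_le _ _ _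
  lift A g hg := by
    rw [lipschitz_one_iff] at hg
    choose k hk using fun x : A => h₃ (fun a => (g a).toFun x) fun a b =>
      (NExp.edist_apply_le (g a) (g b) x).trans (hg a b)
    refine ⟨NExp.mk' k fun x y => h₂ _ _ _ fun a => ?_, fun a => Met.hom_ext fun x => hk x a⟩
    rw [hk, hk]
    exact Met.edist_hom_le _ _ _

end

/-- Powers in the opposite of the category of countable spaces. -/
lemma CMet.isPower_const (A : CMet.{u}) : IsPower A.obj (Opposite.op CMet.point) (Opposite.op A)
    (fun a => (CMet.const a).op) where
  nonexp := (lipschitz_one_iff _).2 fun a b => iSup_le fun _ => le_rfl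
  isometry B h h' := by
    change (⨆ a, edist (h.unop.hom.toFun a) (h'.unop.hom.toFun a)) =
      ⨆ a, ⨆ _ : PUnit, edist (h.unop.hom.toFun a) (h'.unop.hom.toFun a)
    simp
  lift B g hg := by
    refine ⟨(ObjectProperty.homMk (P := fun X : Met.{u} => Countable X) (X := A) (Y := B.unop)
      (NExp.mk' (fun a => (g a).unop.hom.toFun ⟨⟩) fun a b => ?_)).op, fun a => ?_⟩
    · exact (le_iSup (fun t : PUnit => edist ((g a).unop.hom.toFun t) ((g b).unop.hom.toFun t))
        ⟨⟩).trans ((lipschitz_one_iff _).1 hg a b)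
    · rfl

/-! ### Countable powers of the generating object -/

namespace LawvereTheory

variable (L : LawvereTheory.{u})

lemma isPower_proj (A : CMet.{u}) : IsPower A.obj L.x (L.pow A) fun a => L.proj a :=
  have := A.property
  L.preservesPowers _ _ _ _ (CMet.isPower_const A)

/-- The projection `x ^ C ⟶ x` of a metric cardinal. -/
def pr {C : MetricCardinal} (i : C) : L.pow C.toCMet ⟶ L.x := L.proj (A := C.toCMet) (ULift.up i)

lemma isPower_pr (C : MetricCardinal) :
    IsPower (ULift.{u} C) L.x (L.pow C.toCMet) fun i => L.pr i.down :=
  L.isPower_proj C.toCMet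

lemma edist_pr_le {C : MetricCardinal} (i j : C) : edist (L.pr i) (L.pr j) ≤ edist i j :=
  (lipschitz_one_iff _).1 (L.isPower_pr C).nonexp ⟨i⟩ ⟨j⟩

lemma exists_tuple {C : MetricCardinal} {X : L.Obj} (m : C → (X ⟶ L.x))
    (hm : ∀ i j, edist (m i) (m j) ≤ edist i j) :
    ∃ h : X ⟶ L.pow C.toCMet, ∀ i, h ≫ L.pr i = m i := by
  obtain ⟨h, hh⟩ := (L.isPower_pr C).lift X (fun i => m i.down)
    ((lipschitz_one_iff _).2 fun i j => hm _ _)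
  exact ⟨h, fun i => hh ⟨i⟩⟩

lemma pow_hom_ext {C : MetricCardinal} {X : L.Obj} {h h' : X ⟶ L.pow C.toCMet}
    (H : ∀ i, h ≫ L.pr i = h' ≫ L.pr i) : h = h' :=
  (L.isPower_pr C).hom_ext fun i => H i.down

variable {L} in
/-- Every countable power of `x` is isomorphic to a power by a metric cardinal. -/
lemma exists_presentation {W : Type u} [EMetricSpace W] [Countable W] {P : L.Obj}
    {l : W → (P ⟶ L.x)} (hl : IsPower W L.x P l) :
    ∃ (C : MetricCardinal) (e : C ≃ W) (θ : L.pow C.toCMet ⟶ P) (τ : P ⟶ L.pow C.toCMet),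
      (∀ i j, edist (e i) (e j) = edist i j) ∧ (∀ i, θ ≫ l (e i) = L.pr i) ∧
      (∀ i, τ ≫ L.pr i = l (e i)) ∧ τ ≫ θ = 𝟙 P := by
  obtain ⟨C, e, he⟩ := exists_metricCardinal W
  obtain ⟨τ, hτ⟩ := L.exists_tuple (fun i => l (e i)) fun i j =>
    ((lipschitz_one_iff _).1 hl.nonexp _ _).trans (he i j).le
  obtain ⟨θ, hθ⟩ := hl.lift (L.pow C.toCMet) (fun w => L.pr (e.symm w))
    ((lipschitz_one_iff _).2 fun v w => (L.edist_pr_le _ _).trans (by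
      rw [← he, e.apply_symm_apply, e.apply_symm_apply]))
  refine ⟨C, e, θ, τ, he, fun i => by simp [hθ], hτ, hl.hom_ext fun w => ?_⟩
  rw [Category.assoc, hθ, hτ, e.apply_symm_apply, Category.id_comp]

/-- Surjectivity of the inclusion on objects makes each object an `x ^ A` with `A` countable. -/
lemma exists_isPower (X : L.Obj) : ∃ (W : Type u) (_ : EMetricSpace W) (_ : Countable W)
    (l : W → (X ⟶ L.x)), IsPower W L.x X l := by
  obtain ⟨⟨A⟩, rfl⟩ := L.bijective_obj.2 X
  exact ⟨A.obj, inferInstance, A.property, _, L.isPower_proj A⟩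

/-! ### The theory is a metric equational theory -/

lemma deducible_ok_basic {C : MetricCardinal} (f : L.pow C.toCMet ⟶ L.x)
    (S : Set (Judgment L.signature)) : Deducible S (.ok C.context (L.basic f)) :=
  .app _ _ _ (fun i => .var _ _) fun (i j : C) δ hδ =>
    .assum _ _ _ _ ⟨⟨(i, j), by
      change edist i j ≠ ⊤
      rw [show edist i j = δ from hδ]
      exact ENNReal.coe_ne_top⟩, by
        change (i.val, (edist i j).toNNReal, j.val) = _
        rw [show edist i j = δ from hδ, ENNReal.toNNReal_coe]⟩

/-- Only the left side of the composition axiom needs an argument: the terms `[g i]` must be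
provably within `d(i, j)`. This follows from the distance axioms, as projections depend
nonexpansively on their index. -/
theorem isMET_theory : IsMET L.theory := by
  refine isMET_of_axioms (fun Γ t h => by cases h) fun Γ s ε t h => ?_
  cases h with
  | dist f f' ε h => exact ⟨L.deducible_ok_basic f _, L.deducible_ok_basic f' _⟩
  | proj i => exact ⟨L.deducible_ok_basic _ _, .var _ _⟩
  | @comp C D f g g' h =>
    refine ⟨.app _ _ _ (fun i => L.deducible_ok_basic _ _) fun (i j : C) δ hδ => ?_,
      L.deducible_ok_basic _ _⟩
    have hle : edist (g i) (g j) ≤ δ := by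
      rw [← h, ← h]
      exact ((edist_comp_left_le _ _ _).trans (L.edist_pr_le i j)).trans_eq hδ
    obtain ⟨ε, hε⟩ := (⟨_, ENNReal.coe_toNNReal (ne_top_of_le_ne_top ENNReal.coe_ne_top hle)⟩ :
      ∃ ε : ℝ≥0, (ε : ℝ≥0∞) = edist (g i) (g j))
    have hd : Deducible {J | L.Axioms J} (.eq D.context (L.basic (g i)) ε (L.basic (g j))) :=
      .ax (.dist _ _ _ hε.symm)
    rw [← hε, ENNReal.coe_le_coe] at hle
    -- The axiom gives the exact distance of `g i` and `g j`; the rule `max` only passes to strictly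
    -- larger bounds.
    rcases hle.eq_or_lt with rfl | hlt
    · exact hd
    · exact .max _ _ _ _ _ hlt hd

end LawvereTheory

end MetEq

namespace MetEq

open Limits

namespace LawvereTheory

variable (L : LawvereTheory.{u})

/-! ### The model of the theory given by a model of the Lawvere theory -/

/-- The operation symbols of arity `C`. -/
abbrev Symb (C : MetricCardinal) : Type u := L.pow C.toCMet ⟶ L.x

section

variable {L} (M : L.Model)

lemma Model.isPower {V : Type u} [EMetricSpace V] [Countable V] {X P : L.Obj} {l : V → (P ⟶ X)}
    (hl : IsPower V X P l) : IsPower V (M.obj.obj X) (M.obj.obj P) fun a => M.obj.map (l a) :=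
  M.property.2 _ _ _ _ hl

lemma Model.isPower_pr (C : MetricCardinal) : IsPower (ULift.{u} C) (M.obj.obj L.x)
    (M.obj.obj (L.pow C.toCMet)) fun i => M.obj.map (L.pr i.down) :=
  M.isPower (L.isPower_pr C)

lemma Model.map_comp_apply {X Y Z : L.Obj} (f : X ⟶ Y) (g : Y ⟶ Z) (p : M.obj.obj X) :
    (M.obj.map (f ≫ g)).toFun p = (M.obj.map g).toFun ((M.obj.map f).toFun p) := by
  rw [M.obj.map_comp]
  rfl

lemma Model.exists_tuple {C : MetricCardinal} (m : NExp C (M.obj.obj L.x)) :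
    ∃ p : M.obj.obj (L.pow C.toCMet), ∀ i, (M.obj.map (L.pr i)).toFun p = m.toFun i := by
  obtain ⟨p, hp⟩ := (M.isPower_pr C).exists_point (fun i => m.toFun i.down)
    fun i j => m.edist_le _ _
  exact ⟨p, fun i => hp ⟨i⟩⟩

/-- The point of `M(x ^ C)` given by a tuple in `M(x)`. -/
def Model.tuple {C : MetricCardinal} (m : NExp C (M.obj.obj L.x)) :
    M.obj.obj (L.pow C.toCMet) := (M.exists_tuple m).choose

lemma Model.pr_tuple {C : MetricCardinal} (m : NExp C (M.obj.obj L.x)) (i : C) :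
    (M.obj.map (L.pr i)).toFun (M.tuple m) = m.toFun i := (M.exists_tuple m).choose_spec i

lemma Model.tuple_eq {C : MetricCardinal} {m : NExp C (M.obj.obj L.x)}
    {p : M.obj.obj (L.pow C.toCMet)} (h : ∀ i, (M.obj.map (L.pr i)).toFun p = m.toFun i) :
    M.tuple m = p :=
  (M.isPower_pr C).apply_ext fun i => by rw [M.pr_tuple, h]

lemma Model.edist_tuple_le {C : MetricCardinal} (m n : NExp C (M.obj.obj L.x)) :
    edist (M.tuple m) (M.tuple n) ≤ edist m n :=
  (M.isPower_pr C).edist_apply_le fun i => by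
    rw [M.pr_tuple, M.pr_tuple]
    exact NExp.edist_apply_le m n i.down

/-- The space `M(x)` with its operations. -/
def Model.toSigModel : SigModel (opSignature L.Symb) where
  space := M.obj.obj L.x
  op f := NExp.mk' (fun m => (M.obj.map f.2).toFun (M.tuple m)) fun m n =>
    (Met.edist_hom_le _ _ _).trans (M.edist_tuple_le m n)

lemma Model.ap_apply {C : MetricCardinal} (f : L.Symb C) (m : NExp C (M.obj.obj L.x)) :
    (M.toSigModel.ap f).toFun m = (M.obj.map f).toFun (M.tuple m) := rfl

lemma Model.edist_map_le {X Y : L.Obj} (f g : X ⟶ Y) (p : M.obj.obj X) :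
    edist ((M.obj.map f).toFun p) ((M.obj.map g).toFun p) ≤ edist f g :=
  (NExp.edist_apply_le _ _ p).trans (M.property.1 f g)

/-- Naturality at `f`, and at the projections to move `φ` inside the tuple. -/
lemma Model.app_ap {N : L.Model} (φ : M ⟶ N) {C : MetricCardinal} (f : L.Symb C)
    (m : NExp C (M.obj.obj L.x)) : (φ.hom.app L.x).toFun ((M.toSigModel.ap f).toFun m) =
      (N.toSigModel.ap f).toFun (m.comp (φ.hom.app L.x)) := by
  rw [M.ap_apply]
  refine Eq.trans (Met.congr_toFun (φ.hom.naturality f) _) (congrArg (N.obj.map f).toFun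
    (N.tuple_eq fun i => ?_).symm)
  refine (Met.congr_toFun (φ.hom.naturality (L.pr i)) (M.tuple m)).symm.trans ?_
  exact congrArg (φ.hom.app L.x).toFun (M.pr_tuple m i)

lemma Model.satisfies_axioms {J : Judgment L.signature} (hJ : L.Axioms J) :
    SigModel.Satisfies (Ω := L.signature) M.toSigModel J := by
  cases hJ with
  | @dist C f f' ε h =>
    exact (M.toSigModel.satisfies_dist_iff (P := L.Symb) f f' ε).2 fun m =>
      (M.edist_map_le f f' (M.tuple m)).trans_eq h
  | @proj C i =>
    exact (M.toSigModel.satisfies_proj_iff (P := L.Symb) (L.pr i) i).2 fun m => M.pr_tuple m i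
  | @comp C D f g g' h =>
    have hg (i : C) : g i = g' ≫ L.pr i := (h i).symm
    refine (M.toSigModel.satisfies_comp_iff (P := L.Symb) f g (g' ≫ f)).2
      ⟨fun m i j => ?_, fun m => ?_⟩
    · refine (M.edist_map_le (g i) (g j) (M.tuple m)).trans ?_
      rw [hg, hg]
      exact (edist_comp_left_le _ _ _).trans (L.edist_pr_le i j)
    · refine Eq.trans ?_ (M.map_comp_apply g' f (M.tuple m)).symm
      refine congrArg (M.obj.map f).toFun (M.tuple_eq fun i => ?_)
      refine (M.map_comp_apply g' (L.pr i) (M.tuple m)).symm.trans ?_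
      rw [← hg]
      rfl

end

/-- The functor from models of a Lawvere theory to models of its metric equational theory. -/
def toTheory : L.Model ⥤ TheoryModel L.theory where
  obj M := ⟨M.toSigModel, fun _ hJ =>
    SigModel.satisfies_of_deducible (Ω := L.signature) M.toSigModel
      (fun _ h => M.satisfies_axioms h) hJ⟩
  map {M N} φ := ObjectProperty.homMk (SigModel.Hom.mk (Ω := L.signature) (M := M.toSigModel)
    (N := N.toSigModel) (φ.hom.app L.x) fun f m => M.app_ap φ f.2 m)

lemma toTheory_forget : L.toTheory ⋙ TheoryModel.forget L.theory = L.forget := rfl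

/-- Projections measure distances in a power, and by naturality they express the component at `X`
through the one at `x`; so the supremum over all components is reached at `x`. -/
lemma edist_toTheory_map {M N : L.Model} (φ ψ : M ⟶ N) :
    edist (L.toTheory.map φ) (L.toTheory.map ψ) = edist φ ψ := by
  change edist (φ.hom.app L.x) (ψ.hom.app L.x) = ⨆ X, edist (φ.hom.app X) (ψ.hom.app X)
  apply le_antisymm
  · exact le_iSup (fun X => edist (φ.hom.app X) (ψ.hom.app X)) L.x
  · refine iSup_le fun X => (NExp.edist_le_iff _ _ _).2 fun p => ?_
    obtain ⟨W, _, _, l, hl⟩ := L.exists_isPower X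
    refine (N.isPower hl).edist_apply_le fun w => ?_
    have h (χ : M ⟶ N) : (N.obj.map (l w)).toFun ((χ.hom.app X).toFun p) =
        (χ.hom.app L.x).toFun ((M.obj.map (l w)).toFun p) :=
      (Met.congr_toFun (χ.hom.naturality (l w)) p).symm
    rw [h, h]
    exact NExp.edist_apply_le _ _ _

instance : L.toTheory.Faithful where
  map_injective {M N φ ψ} h := eq_of_edist_eq_zero (by
    rw [← L.edist_toTheory_map, h, edist_self])

/-! ### Fullness -/

variable {L}

lemma TheoryModel.map_ap {M N : TheoryModel L.theory} (φ : M ⟶ N) {C : MetricCardinal}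
    (f : L.Symb C) (m : NExp C M.obj.space) :
    φ.hom.toNExp.toFun ((SigModel.ap (P := L.Symb) M.obj f).toFun m) =
      (SigModel.ap (P := L.Symb) N.obj f).toFun (m.comp φ.hom.toNExp) :=
  φ.hom.map_op ⟨C, f⟩ m

/-- The projections of `X` define `ψ`. The point is compatibility with an arbitrary `g`: along a
presentation of `X`, `g` becomes the symbol `θ ≫ g` applied to projections, and `φ` commutes with
symbols. -/
lemma exists_component {M N : L.Model} (φ : L.toTheory.obj M ⟶ L.toTheory.obj N) (X : L.Obj) :
    ∃ ψ : M.obj.obj X ⟶ N.obj.obj X, ∀ (g : X ⟶ L.x) (p : M.obj.obj X),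
      (N.obj.map g).toFun (ψ.toFun p) = φ.hom.toNExp.toFun ((M.obj.map g).toFun p) := by
  obtain ⟨W, _, _, l, hl⟩ := L.exists_isPower X
  obtain ⟨h, hh⟩ := (N.isPower hl).lift _
    (fun w => (M.obj.map (l w) ≫ (φ.hom.toNExp : M.obj.obj L.x ⟶ N.obj.obj L.x)))
    ((lipschitz_one_iff _).2 fun v w => (edist_comp_right_le _ _ _).trans
      ((M.property.1 _ _).trans ((lipschitz_one_iff _).1 hl.nonexp v w)))
  refine ⟨h, fun g p => ?_⟩
  obtain ⟨C, e, θ, τ, he, hθ, hτ, hτθ⟩ := exists_presentation hl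
  have hg : g = τ ≫ θ ≫ g := by rw [← Category.assoc, hτθ, Category.id_comp]
  let m : NExp C (M.obj.obj L.x) := NExp.mk' (fun i => (M.obj.map (L.pr i)).toFun
    ((M.obj.map τ).toFun p)) fun i j => (M.edist_map_le _ _ _).trans (L.edist_pr_le i j)
  have h₁ : (M.obj.map g).toFun p = (M.toSigModel.ap (θ ≫ g)).toFun m := by
    rw [M.ap_apply, M.tuple_eq (p := (M.obj.map τ).toFun p) fun i => rfl, ← M.map_comp_apply, ← hg]
  rw [h₁]
  refine Eq.trans ?_ (TheoryModel.map_ap φ (θ ≫ g) m).symm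
  refine Eq.trans ?_ (congrArg (N.obj.map (θ ≫ g)).toFun
    (N.tuple_eq (p := (N.obj.map τ).toFun (h.toFun p)) fun i => ?_).symm)
  · rw [← N.map_comp_apply, ← hg]
  rw [← N.map_comp_apply, hτ]
  refine (Met.congr_toFun (hh (e i)) p).trans ?_
  change φ.hom.toNExp.toFun ((M.obj.map (l (e i))).toFun p) =
    φ.hom.toNExp.toFun ((M.obj.map (L.pr i)).toFun ((M.obj.map τ).toFun p))
  rw [← M.map_comp_apply, hτ]

lemma Model.point_ext (M : L.Model) {X : L.Obj} {p q : M.obj.obj X}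
    (h : ∀ g : X ⟶ L.x, (M.obj.map g).toFun p = (M.obj.map g).toFun q) : p = q := by
  obtain ⟨W, _, _, l, hl⟩ := L.exists_isPower X
  exact (M.isPower hl).apply_ext fun w => h (l w)

variable (L)

/-- Naturality squares are tested after maps into `x`, which separate the points of `N(Y)`. -/
instance : L.toTheory.Full where
  map_surjective {M N} φ := by
    choose ψ hψ using exists_component φ
    refine ⟨ObjectProperty.homMk ⟨ψ, fun X Y f => Met.hom_ext fun p => N.point_ext fun g => ?_⟩, ?_⟩
    · change (N.obj.map g).toFun ((ψ Y).toFun ((M.obj.map f).toFun p)) =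
        (N.obj.map g).toFun ((N.obj.map f).toFun ((ψ X).toFun p))
      rw [hψ, ← N.map_comp_apply, hψ, M.map_comp_apply]
    · refine ObjectProperty.hom_ext _ (SigModel.Hom.ext (NExp.ext_apply fun p => ?_))
      have := hψ L.x (𝟙 _) p
      rw [N.obj.map_id, M.obj.map_id] at this
      exact this

end LawvereTheory

end MetEq

namespace MetEq

open Limits

namespace LawvereTheory

variable {L : LawvereTheory.{u}}

/-! ### Operations in models of the theory -/

namespace TheoryModel

variable (N : TheoryModel L.theory)

/-- The operation of a model given by a morphism of the Lawvere theory. -/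
def ap {C : MetricCardinal} (f : L.Symb C) : NExp (NExp C N.obj.space) N.obj.space :=
  SigModel.ap (P := L.Symb) N.obj f

lemma edist_ap_le {C : MetricCardinal} (f f' : L.Symb C) (m : NExp C N.obj.space) :
    edist ((ap N f).toFun m) ((ap N f').toFun m) ≤ edist f f' := by
  by_cases h : edist f f' = ⊤
  · rw [h]
    exact le_top
  · have h' := (ENNReal.coe_toNNReal h).symm
    rw [h']
    exact (SigModel.satisfies_dist_iff (P := L.Symb) N.obj f f' _).1
      (N.property _ (.ax (.dist _ _ _ h'))) m

lemma ap_pr {C : MetricCardinal} (i : C) (m : NExp C N.obj.space) :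
    (ap N (L.pr i)).toFun m = m.toFun i :=
  (SigModel.satisfies_proj_iff (P := L.Symb) N.obj (L.pr i) i).1
    (N.property _ (.ax (.proj i))) m

/-- The tuple of operations given by a morphism `x ^ D ⟶ x ^ C`. -/
def apTuple {C D : MetricCardinal} (g : L.pow D.toCMet ⟶ L.pow C.toCMet)
    (m : NExp D N.obj.space) : NExp C N.obj.space :=
  NExp.mk' (fun i => (ap N (g ≫ L.pr i)).toFun m) fun i j =>
    (edist_ap_le N _ _ _).trans ((edist_comp_left_le _ _ _).trans (L.edist_pr_le i j))

lemma ap_comp {C D : MetricCardinal} (g : L.pow D.toCMet ⟶ L.pow C.toCMet) (f : L.Symb C)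
    (m : NExp D N.obj.space) :
    (ap N (g ≫ f)).toFun m = (ap N f).toFun (apTuple N g m) := by
  obtain ⟨_, h⟩ := (SigModel.satisfies_comp_iff (P := L.Symb) N.obj f (fun i => g ≫ L.pr i)
    (g ≫ f)).1 (N.property _ (.ax (.comp _ _ g fun i => rfl)))
  exact (h m).symm

end TheoryModel

/-! ### Representable models -/

/-- The model `L(X, -)`. -/
def repModel (X : L.Obj) : L.Model where
  obj :=
    { obj Y := ⟨X ⟶ Y⟩
      map f := NExp.mk' (fun h => h ≫ f) fun h h' => edist_comp_right_le h h' f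
      map_id _ := Met.hom_ext fun h => Category.comp_id h
      map_comp f g := Met.hom_ext fun h => (Category.assoc h f g).symm }
  property := ⟨fun _ _ f g => (NExp.edist_le_iff _ _ _).2 fun h => edist_comp_left_le h f g,
    fun _ _ _ _ _ _ hl => Met.isPower_of
      (fun a b => (NExp.edist_le_iff _ _ _).2 fun h => (edist_comp_left_le h _ _).trans
        ((lipschitz_one_iff _).1 hl.nonexp a b))
      (fun _ _ _ h => hl.edist_le h)
      fun m hm => hl.lift X m ((lipschitz_one_iff _).2 hm)⟩

/-- The map of representable models given by a morphism. -/
def repMap {X Y : L.Obj} (f : X ⟶ Y) : repModel Y ⟶ repModel X :=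
  ObjectProperty.homMk
    { app Z := NExp.mk' (fun h : Y ⟶ Z => f ≫ h) fun h h' => edist_comp_left_le f h h'
      naturality _ _ g := Met.hom_ext fun h => (Category.assoc f h g).symm }

lemma repModel_tuple_pr (X : L.Obj) {C : MetricCardinal} (m : NExp C (X ⟶ L.x)) (i : C) :
    ((repModel X).tuple m : X ⟶ L.pow C.toCMet) ≫ L.pr i = m.toFun i :=
  (repModel X).pr_tuple m i

variable (N : TheoryModel L.theory)

/-- Morphisms from a representable model to `N`. -/
abbrev RepHom (X : L.Obj) : Type u := L.toTheory.obj (repModel X) ⟶ N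

variable {N}

/-- The value of a morphism from a representable model. -/
def RepHom.val {X : L.Obj} (φ : RepHom N X) (g : X ⟶ L.x) : N.obj.space := φ.hom.toNExp.toFun g

lemma RepHom.edist_val_le {X : L.Obj} (φ : RepHom N X) (g g' : X ⟶ L.x) :
    edist (φ.val g) (φ.val g') ≤ edist g g' := φ.hom.toNExp.edist_le g g'

lemma RepHom.edist_le_iff {X : L.Obj} {φ ψ : RepHom N X} {r : ℝ≥0∞} :
    edist φ ψ ≤ r ↔ ∀ g, edist (φ.val g) (ψ.val g) ≤ r :=
  NExp.edist_le_iff φ.hom.toNExp ψ.hom.toNExp r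

lemma RepHom.ext {X : L.Obj} {φ ψ : RepHom N X} (h : ∀ g, φ.val g = ψ.val g) : φ = ψ :=
  ObjectProperty.hom_ext _ (SigModel.Hom.ext (NExp.ext_apply h))

/-- The tuple of values of a morphism from a representable model. -/
def RepHom.valTuple {X : L.Obj} (φ : RepHom N X) {C : MetricCardinal} (τ : X ⟶ L.pow C.toCMet) :
    NExp C N.obj.space :=
  NExp.mk' (fun i => φ.val (τ ≫ L.pr i)) fun i j => (φ.edist_val_le _ _).trans
    ((edist_comp_left_le _ _ _).trans (L.edist_pr_le i j))

/-- In the representable model, `τ ≫ f` is the symbol `f` applied to the components of `τ`, and `φ`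
is a homomorphism. -/
lemma RepHom.val_comp {X : L.Obj} (φ : RepHom N X) {C : MetricCardinal} (τ : X ⟶ L.pow C.toCMet)
    (f : L.Symb C) : φ.val (τ ≫ f) = (TheoryModel.ap N f).toFun (φ.valTuple τ) := by
  let m : NExp C (X ⟶ L.x) := NExp.mk' (fun i => τ ≫ L.pr i) fun i j =>
    (edist_comp_left_le _ _ _).trans (L.edist_pr_le i j)
  have hτ : τ = (repModel X).tuple m := L.pow_hom_ext fun i => by rw [repModel_tuple_pr]; rfl
  refine Eq.trans ?_ (TheoryModel.map_ap φ f m)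
  change φ.val (τ ≫ f) = φ.val (((repModel X).tuple m : X ⟶ L.pow C.toCMet) ≫ f)
  rw [← hτ]

/-- By `RepHom.val_comp` every value is an operation on the values at the projections, and
operations are nonexpansive. -/
lemma RepHom.edist_le {X : L.Obj} {W : Type u} [EMetricSpace W] [Countable W] {l : W → (X ⟶ L.x)}
    (hl : IsPower W L.x X l) {φ ψ : RepHom N X} {r : ℝ≥0∞}
    (h : ∀ w, edist (φ.val (l w)) (ψ.val (l w)) ≤ r) : edist φ ψ ≤ r := by
  refine RepHom.edist_le_iff.2 fun g => ?_
  obtain ⟨C, e, θ, τ, he, hθ, hτ, hτθ⟩ := exists_presentation hl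
  have hg : g = τ ≫ θ ≫ g := by rw [← Category.assoc, hτθ, Category.id_comp]
  rw [hg, RepHom.val_comp, RepHom.val_comp]
  refine (NExp.edist_le _ _ _).trans ((NExp.edist_le_iff _ _ _).2 fun i => ?_)
  change edist (φ.val (τ ≫ L.pr i)) (ψ.val (τ ≫ L.pr i)) ≤ r
  rw [hτ]
  exact h _

lemma RepHom.ext_of_isPower {X : L.Obj} {W : Type u} [EMetricSpace W] [Countable W]
    {l : W → (X ⟶ L.x)} (hl : IsPower W L.x X l) {φ ψ : RepHom N X}
    (h : ∀ w, φ.val (l w) = ψ.val (l w)) : φ = ψ :=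
  eq_of_edist_eq_zero (le_antisymm (RepHom.edist_le hl fun w => by rw [h, edist_self]) bot_le)

/-- Freeness of the representable model on the projections: `g` is sent to the operation `θ ≫ g` at
the given family. The distance axioms make this nonexpansive, the composition axioms make it a
homomorphism, and the projection axioms give the values on generators. -/
lemma RepHom.exists_val {X : L.Obj} {W : Type u} [EMetricSpace W] [Countable W]
    {l : W → (X ⟶ L.x)} (hl : IsPower W L.x X l) (m : W → N.obj.space)
    (hm : ∀ v w, edist (m v) (m w) ≤ edist v w) :
    ∃ φ : RepHom N X, ∀ w, φ.val (l w) = m w := by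
  obtain ⟨C, e, θ, τ, he, hθ, hτ, hτθ⟩ := exists_presentation hl
  let m' : NExp C N.obj.space := NExp.mk' (fun i => m (e i)) fun i j => (hm _ _).trans (he i j).le
  let φ : NExp (X ⟶ L.x) N.obj.space := NExp.mk' (fun g => (TheoryModel.ap N (θ ≫ g)).toFun m')
    fun g g' => (TheoryModel.edist_ap_le N _ _ _).trans (edist_comp_left_le _ _ _)
  have hφ {D : MetricCardinal} (f : L.Symb D) (k : NExp D (X ⟶ L.x)) (κ : X ⟶ L.pow D.toCMet)
      (hκ : ∀ i, κ ≫ L.pr i = k.toFun i) :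
      φ.toFun (κ ≫ f) = (TheoryModel.ap N f).toFun (k.comp φ) := by
    change (TheoryModel.ap N (θ ≫ κ ≫ f)).toFun m' = _
    rw [← Category.assoc, TheoryModel.ap_comp]
    congr 1
    refine NExp.ext_apply fun i => ?_
    change (TheoryModel.ap N ((θ ≫ κ) ≫ L.pr i)).toFun m'
      = (TheoryModel.ap N (θ ≫ k.toFun i)).toFun m'
    rw [Category.assoc, hκ]
  refine ⟨ObjectProperty.homMk (SigModel.Hom.mk (Ω := L.signature)
    (M := (repModel X).toSigModel) (N := N.obj) φ fun f k =>
      hφ f.2 k _ (repModel_tuple_pr X k)), fun w => ?_⟩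
  obtain ⟨i, rfl⟩ := e.surjective w
  change (TheoryModel.ap N (θ ≫ l (e i))).toFun m' = _
  rw [hθ, TheoryModel.ap_pr]
  rfl

/-! ### Essential surjectivity -/

variable (N)

/-- The model of the Lawvere theory given by a model of its metric equational theory. -/
def repHomFunctor : L.Obj ⥤ Met.{u} where
  obj X := ⟨RepHom N X⟩
  map f := NExp.mk' (fun φ => L.toTheory.map (repMap f) ≫ φ) fun _ _ =>
    RepHom.edist_le_iff.2 fun g => RepHom.edist_le_iff.1 le_rfl (f ≫ g)
  map_id _ := Met.hom_ext fun φ => RepHom.ext fun g =>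
    congrArg φ.val (Category.id_comp g)
  map_comp f g := Met.hom_ext fun φ => RepHom.ext fun h =>
    congrArg φ.val (Category.assoc f g h)

lemma repHomFunctor_val {X Y : L.Obj} (f : X ⟶ Y) (φ : RepHom N X) (g : Y ⟶ L.x) :
    RepHom.val (((repHomFunctor N).map f).toFun φ) g = φ.val (f ≫ g) := rfl

lemma repHomFunctor_isMetFunctor : IsMetFunctor (repHomFunctor N) := fun _ _ f g =>
  (NExp.edist_le_iff _ _ _).2 fun φ => RepHom.edist_le_iff.2 fun h =>
    (RepHom.edist_val_le φ (f ≫ h) (g ≫ h)).trans (edist_comp_right_le _ _ _)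

/-- A `V`-power of a `W`-power of `x` is a power by the tensor product, so the homomorphisms in
question are families on `TensorProd V W`. The sum metric makes families that are nonexpansive in
each variable jointly nonexpansive. -/
lemma repHomFunctor_preserves : PreservesCountablePowers.{u} (repHomFunctor N) := by
  intro V _ _ X P l hl
  obtain ⟨W, _, _, l', hl'⟩ := L.exists_isPower X
  refine Met.isPower_of (fun a b => (repHomFunctor_isMetFunctor N _ _).trans
    ((lipschitz_one_iff _).1 hl.nonexp a b)) (fun φ ψ r h => ?_) fun m hm => ?_
  · exact RepHom.edist_le (hl.comp hl') fun q => RepHom.edist_le_iff.1 (h q.fst) (l' q.snd)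
  · obtain ⟨φ, hφ⟩ := RepHom.exists_val (hl.comp hl')
      (fun q => RepHom.val (m q.fst) (l' q.snd)) fun p q => by
        refine (edist_triangle _ (RepHom.val (m q.fst) (l' p.snd)) _).trans (add_le_add ?_ ?_)
        · exact RepHom.edist_le_iff.1 (hm _ _) _
        · exact (RepHom.edist_val_le _ _ _).trans ((lipschitz_one_iff _).1 hl'.nonexp _ _)
    exact ⟨φ, fun v => RepHom.ext_of_isPower hl' fun w => hφ ⟨v, w⟩⟩

/-- The model `X ↦ Hom(L(X, x), N)` of the Lawvere theory. -/
def repHomModel : L.Model :=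
  ⟨repHomFunctor N, repHomFunctor_isMetFunctor N, repHomFunctor_preserves N⟩

end LawvereTheory

/-- A bijective isometric homomorphism is an isomorphism. -/
lemma SigModel.exists_inverse {Ω : Signature.{u}} {M N : SigModel Ω} (φ : M ⟶ N)
    (h : Function.Surjective φ.toNExp.toFun)
    (h' : ∀ x y, edist x y ≤ edist (φ.toNExp.toFun x) (φ.toNExp.toFun y)) :
    ∃ ψ : N ⟶ M, φ ≫ ψ = 𝟙 M ∧ ψ ≫ φ = 𝟙 N := by
  have hinj : Function.Injective φ.toNExp.toFun := fun x y hxy =>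
    eq_of_edist_eq_zero (le_antisymm ((h' x y).trans (by rw [hxy, edist_self])) bot_le)
  choose k hk using h
  let κ : NExp N.space M.space := NExp.mk' k fun x y => (h' _ _).trans (by rw [hk, hk])
  refine ⟨⟨κ, fun f m => hinj ?_⟩, SigModel.Hom.ext (NExp.ext_apply fun x => hinj (hk _)),
    SigModel.Hom.ext (NExp.ext_apply fun x => hk x)⟩
  refine (hk _).trans (Eq.trans ?_ (φ.map_op f (m.comp κ)).symm)
  exact congrArg (N.op f).toFun (NExp.ext_apply fun i => (hk _).symm)

/-! ### Recovering a model by evaluation at the identity -/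

namespace LawvereTheory

variable {L : LawvereTheory.{u}} (N : TheoryModel L.theory)

/-- Evaluation at the identity. -/
def evalOne : (repHomModel N).toSigModel.space ⟶ N.obj.space :=
  NExp.mk' (fun φ : RepHom N L.x => φ.val (𝟙 L.x)) fun _ _ => RepHom.edist_le_iff.1 le_rfl _

lemma evalOne_ap {C : MetricCardinal} (f : L.Symb C)
    (m : NExp C (repHomModel N).toSigModel.space) :
    (evalOne N).toFun (((repHomModel N).toSigModel.ap f).toFun m) =
      (TheoryModel.ap N f).toFun (m.comp (evalOne N)) := by
  let k : RepHom N (L.pow C.toCMet) := (repHomModel N).tuple m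
  have hk (i : C) : ((repHomFunctor N).map (L.pr i)).toFun k = m.toFun i :=
    (repHomModel N).pr_tuple m i
  change k.val (f ≫ 𝟙 L.x) = _
  rw [Category.comp_id, ← Category.id_comp f, RepHom.val_comp, Category.id_comp]
  congr 1
  refine NExp.ext_apply fun i => ?_
  change k.val (𝟙 _ ≫ L.pr i) = RepHom.val (m.toFun i) (𝟙 L.x)
  rw [← hk, repHomFunctor_val, Category.id_comp, Category.comp_id]

/-- As `x` is its own power by a point, with the identity as projection, freeness says that
evaluation at the identity is a surjective isometry. -/
instance : L.toTheory.EssSurj where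
  mem_essImage N := by
    let φ : (repHomModel N).toSigModel ⟶ N.obj :=
      SigModel.Hom.mk (Ω := L.signature) (evalOne N) fun f m => evalOne_ap N f.2 m
    obtain ⟨ψ, h₁, h₂⟩ := SigModel.exists_inverse φ
      (fun n => by
        obtain ⟨k, hk⟩ := RepHom.exists_val (N := N) (isPower_punit L.x) (fun _ => n) (by simp)
        exact ⟨k, hk ⟨⟩⟩)
      fun x y => RepHom.edist_le (N := N) (isPower_punit L.x) fun _ => le_rfl
    exact ⟨repHomModel N, ⟨{
      hom := ObjectProperty.homMk φ
      inv := ObjectProperty.homMk ψ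
      hom_inv_id := ObjectProperty.hom_ext _ h₁
      inv_hom_id := ObjectProperty.hom_ext _ h₂ }⟩⟩

instance : L.toTheory.IsEquivalence where

variable (L) in
/-- The models of a Lawvere theory are the models of its metric equational theory. -/
theorem exists_equivalence : ∃ E : L.Model ≌ TheoryModel L.theory,
    E.functor ⋙ TheoryModel.forget L.theory = L.forget ∧
    ∀ (M N : L.Model) (φ ψ : M ⟶ N), edist (E.functor.map φ) (E.functor.map ψ) = edist φ ψ :=
  ⟨L.toTheory.asEquivalence, L.toTheory_forget, fun _ _ => L.edist_toTheory_map⟩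

end LawvereTheory

end MetEq

namespace MetEq

open Limits

/-! ### Countably filtered colimits of models -/

section ColimitModel

variable {Ω : Signature.{u}} {T : Set (Judgment Ω)} {J : Type u} [SmallCategory J]
  {G : J ⥤ TheoryModel T} {c : Cocone (G ⋙ TheoryModel.forget T)}

/-- The map from a stage to the vertex of a cocone. -/
def toVertex (c : Cocone (G ⋙ TheoryModel.forget T)) (j : J) : NExp (G.obj j).obj.space c.pt :=
  c.ι.app j

/-- The transition maps on underlying spaces. -/
def trans (G : J ⥤ TheoryModel T) {j k : J} (f : j ⟶ k) :
    NExp (G.obj j).obj.space (G.obj k).obj.space :=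
  (G.map f).hom.toNExp

lemma toVertex_trans {j k : J} (f : j ⟶ k) (x : (G.obj j).obj.space) :
    (toVertex c k).toFun ((trans G f).toFun x) = (toVertex c j).toFun x :=
  cocone_w_apply c f x

variable [IsCardinalFiltered J (Cardinal.aleph 1 : Cardinal.{u})]

lemma exists_lift_nexp (hc : IsTight c) {C : Type w} [EMetricSpace C] [Countable C] (m : NExp C c.pt) :
    ∃ (j : J) (x : NExp C (G.obj j).obj.space), x.comp (toVertex c j) = m := by
  obtain ⟨j, x, hx, h⟩ := hc.exists_lift m.toFun
  exact ⟨j, NExp.mk' (X := C) (Y := (G.obj j).obj.space) x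
    fun i i' => (h i i').trans (m.edist_le i i'), NExp.ext_apply hx⟩

/-- Compare the tuples at a stage attaining their countably many distances. The bound shows that
operations on the colimit are independent of the chosen lift and nonexpansive. -/
lemma edist_toVertex_op_le (hc : IsTight c) {f : Ω.Op} {j k : J} (x : NExp (Ω.arity f) (G.obj j).obj.space)
    (y : NExp (Ω.arity f) (G.obj k).obj.space) :
    edist ((toVertex c j).toFun (((G.obj j).obj.op f).toFun x))
      ((toVertex c k).toFun (((G.obj k).obj.op f).toFun y)) ≤
    edist (x.comp (toVertex c j)) (y.comp (toVertex c k)) := by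
  obtain ⟨l, a, b, h⟩ := hc.exists_edist_le_of_ne (ι := Ω.arity f) (j := j) (k := k)
    x.toFun y.toFun
  have hop {j : J} (a : j ⟶ l) (x : NExp (Ω.arity f) (G.obj j).obj.space) :
      (trans G a).toFun (((G.obj j).obj.op f).toFun x) =
        ((G.obj l).obj.op f).toFun (x.comp (trans G a)) := (G.map a).hom.map_op f x
  rw [← toVertex_trans a, ← toVertex_trans b, hop, hop]
  refine (NExp.edist_le _ _ _).trans ((NExp.edist_le _ _ _).trans
    ((NExp.edist_le_iff _ _ _).2 fun i => ?_))
  exact (h i).trans (NExp.edist_apply_le (x.comp (toVertex c j)) (y.comp (toVertex c k)) i)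

variable (hc : IsTight c)

/-- The operations on the colimit of models. -/
def colimitModel : SigModel Ω where
  space := c.pt
  op f := NExp.mk' (fun m => (toVertex c (exists_lift_nexp hc m).choose).toFun
    (((G.obj _).obj.op f).toFun (exists_lift_nexp hc m).choose_spec.choose)) fun m n => by
      refine (edist_toVertex_op_le hc _ _).trans ?_
      rw [(exists_lift_nexp hc m).choose_spec.choose_spec,
        (exists_lift_nexp hc n).choose_spec.choose_spec]

lemma colimitModel_op {f : Ω.Op} {j : J} (x : NExp (Ω.arity f) (G.obj j).obj.space) :
    ((colimitModel hc).op f).toFun (x.comp (toVertex c j)) =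
      (toVertex c j).toFun (((G.obj j).obj.op f).toFun x) := by
  refine eq_of_edist_eq_zero (le_antisymm ((edist_toVertex_op_le hc _ _).trans ?_) bot_le)
  exact ((congrArg (edist · (x.comp (toVertex c j)))
    (exists_lift_nexp hc (x.comp (toVertex c j))).choose_spec.choose_spec).trans
      (edist_self _)).le

/-- There are countably many variables, and lifting does not increase distances, so the lifted
assignment still satisfies `Γ`. -/
lemma exists_lift_assignment {Γ : Context ℕ} (α : (colimitModel hc).Assignment Γ) :
    ∃ (j : J) (β : (G.obj j).obj.Assignment Γ), ∀ n, α.1 n = (toVertex c j).toFun (β.1 n) := by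
  obtain ⟨j, x, hx, h⟩ := hc.exists_lift (ι := ℕ) α.1
  exact ⟨j, ⟨x, fun n ε n' hn => (h n n').trans (α.2 n ε n' hn)⟩, fun n => (hx n).symm⟩

/-- Terms which are defined at each stage are defined in the colimit. -/
lemma exists_mem_interp_colimitModel {Γ : Context ℕ} {t : Preterm Ω ℕ}
    (ht : ∀ j, (G.obj j).obj.Satisfies (.ok Γ t)) :
    ∃ w ∈ (colimitModel hc).interp Γ t, ∀ (j : J) (β : (G.obj j).obj.Assignment Γ)
      (α : (colimitModel hc).Assignment Γ), (∀ n, α.1 n = (toVertex c j).toFun (β.1 n)) →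
      ∀ v ∈ (G.obj j).obj.interp Γ t, w α = (toVertex c j).toFun (v β) := by
  induction t with
  | var n =>
    refine ⟨_, (SigModel.mem_interp_var _).2 rfl, fun j β α h v hv => ?_⟩
    obtain rfl := (SigModel.mem_interp_var _).1 hv
    exact h n
  | op f t ih =>
    choose w hw h using fun i => ih i fun j => (ht j).fst i
    -- Definedness is a bound for each assignment separately, and each comes from a stage where the
    -- term is defined.
    have hd (α) (i j) : edist (w i α) (w j α) ≤ edist i j := by
      obtain ⟨k, β, hβ⟩ := exists_lift_assignment hc α
      obtain ⟨u, hu⟩ := (SigModel.satisfies_ok_iff _).1 (ht k)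
      obtain ⟨v, hv, hd, -⟩ := (SigModel.mem_interp_op _).1 hu
      rw [h i k β α hβ _ (hv i), h j k β α hβ _ (hv j)]
      exact (NExp.edist_le _ _ _).trans (hd β i j)
    refine ⟨_, (SigModel.mem_interp_op _).2 ⟨w, hw, hd, rfl⟩, fun j β α hβ u hu => ?_⟩
    obtain ⟨v, hv, hd', rfl⟩ := (SigModel.mem_interp_op _).1 hu
    dsimp only
    rw [← colimitModel_op hc]
    exact congrArg ((colimitModel hc).op f).toFun
      (NExp.ext_apply fun i => h i j β α hβ _ (hv i))

lemma colimitModel_satisfies {K : Judgment Ω} (hK : K ∈ T) : (colimitModel hc).Satisfies K := by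
  cases K with
  | ok Γ t =>
    obtain ⟨w, hw, -⟩ := exists_mem_interp_colimitModel hc fun j => (G.obj j).property _ hK
    exact (SigModel.satisfies_ok_iff _).2 ⟨w, hw⟩
  | eq Γ s ε t =>
    have hJ (j : J) := (G.obj j).property _ hK
    obtain ⟨w, hw, h⟩ := exists_mem_interp_colimitModel hc (t := s) fun j => (hJ j).fst
    obtain ⟨w', hw', h'⟩ := exists_mem_interp_colimitModel hc (t := t) fun j => (hJ j).snd.fst
    refine (SigModel.satisfies_eq_iff _).2 ⟨w, hw, w', hw', fun α => ?_⟩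
    obtain ⟨k, β, hβ⟩ := exists_lift_assignment hc α
    obtain ⟨v, hv, v', hv', hd⟩ := (SigModel.satisfies_eq_iff _).1 (hJ k)
    rw [h k β α hβ v hv, h' k β α hβ v' hv']
    exact (NExp.edist_le _ _ _).trans (hd β)

/-- The colimit cocone of models. -/
def colimitModelCocone : Cocone G where
  pt := ⟨colimitModel hc, fun _ => colimitModel_satisfies hc⟩
  ι :=
    { app j := ObjectProperty.homMk
        (SigModel.Hom.mk (M := (G.obj j).obj) (N := colimitModel hc) (toVertex c j)
          fun _ x => (colimitModel_op hc x).symm)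
      naturality _ _ f := ObjectProperty.hom_ext _ (SigModel.Hom.ext
        (NExp.ext_apply fun x => toVertex_trans f x)) }

/-- The colimit cocone of models is a colimit. -/
def colimitModelIsColimit : IsColimit (colimitModelCocone hc) where
  desc s := ObjectProperty.homMk
    (SigModel.Hom.mk (M := colimitModel hc) (N := s.pt.obj)
      (hc.desc ((TheoryModel.forget T).mapCocone s)) fun f m => by
        obtain ⟨j, x, rfl⟩ := exists_lift_nexp hc m
        have h (y : (G.obj j).obj.space) :
            (hc.desc ((TheoryModel.forget T).mapCocone s)).toFun ((toVertex c j).toFun y) =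
              (s.ι.app j).hom.toNExp.toFun y :=
          hc.desc_apply ((TheoryModel.forget T).mapCocone s) y
        refine (congrArg _ (colimitModel_op hc x)).trans ((h _).trans
          (((s.ι.app j).hom.map_op f x).trans ?_))
        exact congrArg (s.pt.obj.op f).toFun (NExp.ext_apply fun i => (h _).symm))
  fac s j := ObjectProperty.hom_ext _ (SigModel.Hom.ext (NExp.ext_apply fun x =>
    hc.desc_apply ((TheoryModel.forget T).mapCocone s) x))
  uniq s m hm := ObjectProperty.hom_ext _ (SigModel.Hom.ext (congrArg NExp.toFun
    (hc.isColimit.uniq ((TheoryModel.forget T).mapCocone s) m.hom.toNExp fun j =>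
      congrArg (fun f => f.hom.toNExp) (hm j)) |> NExp.ext))

end ColimitModel

/-- The colimit of the underlying spaces carries a model structure that is a colimit of models;
preserving this one colimit cocone is enough. -/
instance {Ω : Signature.{u}} (T : Set (Judgment Ω)) :
    (TheoryModel.forget T).IsCardinalAccessible (Cardinal.aleph 1 : Cardinal.{u}) where
  preservesColimitOfShape J _ _ :=
    ⟨fun {G} => by
      have hc := colimCocone_isTight (G ⋙ TheoryModel.forget T)
      exact preservesColimit_of_preserves_colimit_cocone (colimitModelIsColimit hc)
        (IsTight.isColimit ⟨hc.surj, hc.dist⟩)⟩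

/-- Monads which come from metric equational theories are of countable arity. -/
theorem ComesFrom.countableArity {R : Monad Met.{u}} {Ω : Signature.{u}} {T : Set (Judgment Ω)}
    (h : ComesFrom R T) : CountableArity R.toFunctor := by
  obtain ⟨F, adj, ⟨e⟩⟩ := h
  have := adj.leftAdjoint_preservesColimits
  exact Functor.isCardinalAccessible_of_natIso
    (show F ⋙ TheoryModel.forget T ≅ R.toFunctor from (monadToFunctor Met).mapIso e) _

end MetEq

namespace MetEq

open Limits

/-! ### Countable subspaces -/

/-- A metric cardinal as a metric space. -/
abbrev MetricCardinal.toMet (C : MetricCardinal) : Met.{u} := ⟨ULift.{u} C⟩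

/-- A map out of a metric cardinal as a morphism. -/
def NExp.toHom {C : MetricCardinal} {X : Met.{u}} (m : NExp C X) : C.toMet ⟶ X :=
  NExp.mk' (fun i => m.toFun i.down) fun i j => m.edist_le i.down j.down

/-- A morphism out of a metric cardinal as a nonexpansive map. -/
def MetricCardinal.ofHom {C : MetricCardinal} {X : Met.{u}} (m : C.toMet ⟶ X) : NExp C X :=
  NExp.mk' (fun i => m.toFun ⟨i⟩) fun i j => Met.edist_hom_le m ⟨i⟩ ⟨j⟩

lemma exists_iso_metricCardinal (A : Met.{u}) [Countable A] :
    ∃ C : MetricCardinal, Nonempty (C.toMet ≅ A) := by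
  obtain ⟨C, e, he⟩ := exists_metricCardinal A
  exact ⟨C, ⟨{
    hom := NExp.mk' (fun i => e i.down) fun i j => (he _ _).le
    inv := NExp.mk' (fun a => ⟨e.symm a⟩) fun a b => by
      change edist (e.symm a) (e.symm b) ≤ _
      rw [← he, e.apply_symm_apply, e.apply_symm_apply]
    hom_inv_id := Met.hom_ext fun i => ULift.ext _ _ (e.symm_apply_apply i.down)
    inv_hom_id := Met.hom_ext fun a => e.apply_symm_apply a }⟩⟩

/-- The countable subspaces of a metric space. -/
abbrev CountableSubspace (X : Met.{u}) : Type u := {A : Set X // A.Countable}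

instance (X : Met.{u}) :
    IsCardinalFiltered (CountableSubspace X) (Cardinal.aleph 1 : Cardinal.{u}) :=
  isCardinalFiltered_preorder _ _ fun K s hK => by
    have : Countable K := by rwa [Cardinal.lt_aleph_one_iff, Cardinal.mk_le_aleph0_iff] at hK
    exact ⟨⟨⋃ k, (s k).1, Set.countable_iUnion fun k => (s k).2⟩,
      fun k => Set.subset_iUnion (fun k => (s k).1) k⟩

/-- The diagram of the countable subspaces. -/
def subspaceFunctor (X : Met.{u}) : CountableSubspace X ⥤ Met.{u} where
  obj A := ⟨A.1⟩
  map f := NExp.mk' (Set.inclusion (leOfHom f)) fun _ _ => le_rfl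

/-- The inclusion of a countable subspace. -/
def subspaceIncl {X : Met.{u}} (A : CountableSubspace X) : (subspaceFunctor X).obj A ⟶ X :=
  NExp.mk' (fun x => x.1) fun _ _ => le_rfl

/-- The cocone of the countable subspaces. -/
def subspaceCocone (X : Met.{u}) : Cocone (subspaceFunctor X) where
  pt := X
  ι := { app A := subspaceIncl A }

/-- Inclusions are isometric, so distances are attained from the start. -/
lemma subspaceCocone_isTight (X : Met.{u}) : IsTight (subspaceCocone X) where
  surj x := ⟨⟨{x}, Set.countable_singleton x⟩, ⟨x, rfl⟩, rfl⟩
  dist A _ _ := ⟨A, 𝟙 A, le_rfl⟩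

/-- A map with countable range factors through a countable subspace. -/
lemma exists_subspace_factor {X Y : Met.{u}} (m : Y ⟶ X) (A : CountableSubspace X)
    (hA : Set.range m.toFun ⊆ A.1) :
    ∃ m' : Y ⟶ (subspaceFunctor X).obj A, m' ≫ subspaceIncl A = m :=
  ⟨NExp.mk' (fun y => ⟨m.toFun y, hA ⟨y, rfl⟩⟩) fun x y => Met.edist_hom_le m x y, rfl⟩

section

variable {F : Met.{u} ⥤ Met.{u}}

/-- `X` is the `ℵ₁`-filtered colimit of its countable subspaces; `F` preserves it, and such colimits
are tight. -/
lemma CountableArity.isTight (hF : CountableArity F) (X : Met.{u}) : IsTight (F.mapCocone (subspaceCocone X)) := by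
  have : F.IsCardinalAccessible (Cardinal.aleph 1 : Cardinal.{u}) := hF
  have := F.preservesColimitsOfShape_of_isCardinalAccessible
    (Cardinal.aleph 1 : Cardinal.{u}) (CountableSubspace X)
  exact isTight_of_isColimit (isColimitOfPreserves F (subspaceCocone_isTight X).isColimit)

/-- Maps from countable spaces to `F(X)` are supported on a countable subspace. -/
lemma CountableArity.exists_factor (hF : CountableArity F) {X : Met.{u}} {V : Type w} [EMetricSpace V] [Countable V]
    (m : NExp V (F.obj X)) : ∃ (D : MetricCardinal) (n : D.toMet ⟶ X) (m' : NExp V (F.obj D.toMet)),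
      m'.comp (F.map n) = m := by
  obtain ⟨A, x, hx, h⟩ := (hF.isTight X).exists_lift m.toFun
  have : Countable ((subspaceFunctor X).obj A) := A.2
  obtain ⟨D, ⟨e⟩⟩ := exists_iso_metricCardinal ((subspaceFunctor X).obj A)
  refine ⟨D, e.hom ≫ subspaceIncl A, NExp.mk' (fun v => (F.map e.inv).toFun (x v))
    fun v w => (Met.edist_hom_le _ _ _).trans ((h v w).trans (m.edist_le v w)),
    NExp.ext_apply fun v => ?_⟩
  change (F.map e.inv ≫ F.map (e.hom ≫ subspaceIncl A)).toFun (x v) = _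
  rw [← F.map_comp, e.inv_hom_id_assoc]
  exact hx v

/-- The distance of two points of `F(X)` is attained on a countable subspace. -/
lemma CountableArity.exists_edist_le (hF : CountableArity F) {X : Met.{u}} {C D : MetricCardinal} (r : F.obj C.toMet)
    (s : F.obj D.toMet) (m : C.toMet ⟶ X) (n : D.toMet ⟶ X) :
    ∃ (E : MetricCardinal) (k : E.toMet ⟶ X) (m' : C.toMet ⟶ E.toMet) (n' : D.toMet ⟶ E.toMet),
      m' ≫ k = m ∧ n' ≫ k = n ∧
      edist ((F.map m').toFun r) ((F.map n').toFun s) ≤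
        edist ((F.map m).toFun r) ((F.map n).toFun s) := by
  let A : CountableSubspace X := ⟨Set.range m.toFun ∪ Set.range n.toFun,
    (Set.countable_range _).union (Set.countable_range _)⟩
  obtain ⟨m₀, hm⟩ := exists_subspace_factor m A Set.subset_union_left
  obtain ⟨n₀, hn⟩ := exists_subspace_factor n A Set.subset_union_right
  -- Both tuples live in the countable subspace `A`; a larger one, `B`, attains the distance in
  -- `F(X)`.
  obtain ⟨B, f, hf⟩ := (hF.isTight X).dist A ((F.map m₀).toFun r) ((F.map n₀).toFun s)
  have : Countable ((subspaceFunctor X).obj B) := B.2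
  obtain ⟨E, ⟨e⟩⟩ := exists_iso_metricCardinal ((subspaceFunctor X).obj B)
  have hB : (subspaceFunctor X).map f ≫ subspaceIncl B =
    subspaceIncl A := (subspaceCocone X).w f
  refine ⟨E, e.hom ≫ subspaceIncl B, m₀ ≫ (subspaceFunctor X).map f ≫ e.inv,
    n₀ ≫ (subspaceFunctor X).map f ≫ e.inv, by simp [hB, hm], by simp [hB, hn], ?_⟩
  have h {V : Met.{u}} (k : V ⟶ (subspaceFunctor X).obj A) (t : F.obj V) :
      (F.map (k ≫ (subspaceFunctor X).map f ≫ e.inv)).toFun t = (F.map e.inv).toFun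
        ((F.map ((subspaceFunctor X).map f)).toFun ((F.map k).toFun t)) := by
    rw [F.map_comp, F.map_comp]
    rfl
  have h' {V : Met.{u}} (k : V ⟶ (subspaceFunctor X).obj A) (t : F.obj V) :
      (F.map (k ≫ subspaceIncl A)).toFun t =
        (F.map (subspaceIncl A)).toFun ((F.map k).toFun t) := by
    rw [F.map_comp]
    rfl
  rw [h, h, ← hm, ← hn, h', h']
  exact (Met.edist_hom_le _ _ _).trans hf

end

/-! ### The theory of a monad -/

section Monad

variable (R : Monad Met.{u})

/-- The operations of arity `C`. -/
abbrev monadSymb (C : MetricCardinal) : Type u := R.obj C.toMet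

variable {R}

/-- The operation given by an element of `R(C)`. -/
def act (N : SigModel (opSignature (monadSymb R))) {C : MetricCardinal} (r : R.obj C.toMet)
    (k : C.toMet ⟶ N.space) : N.space :=
  (N.ap (P := monadSymb R) r).toFun (MetricCardinal.ofHom k)

variable (hR : IsMetFunctor R.toFunctor)

/-- The model given by an algebra. -/
def algModel (A : R.Algebra) : SigModel (opSignature (monadSymb R)) where
  space := A.A
  -- Enrichment of `R` enters here: the operation is nonexpansive in the tuple `m` because `m ↦
  -- R(m)` is.
  op f := NExp.mk' (fun m => A.a.toFun ((R.map m.toHom).toFun f.2)) fun m n =>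
    (Met.edist_hom_le _ _ _).trans ((NExp.edist_apply_le _ _ _).trans
      ((hR _ _).trans ((NExp.edist_le_iff _ _ _).2 fun i => NExp.edist_apply_le m n i.down)))

/-- The theory of the algebras of a monad. -/
def monadTheory : Set (Judgment (opSignature (monadSymb R))) :=
  {J | ∀ M, (∃ A, M = algModel hR A) → M.Satisfies J}

/-- The functor from algebras to models of the theory. -/
def algFunctor : R.Algebra ⥤ TheoryModel (monadTheory hR) where
  obj A := ⟨algModel hR A, fun _ hJ => hJ _ ⟨A, rfl⟩⟩
  map {A B} φ := ObjectProperty.homMk (SigModel.Hom.mk (M := algModel hR A) (N := algModel hR B)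
    φ.f fun f m => by
      refine (Met.congr_toFun φ.h ((R.map m.toHom).toFun f.2)).symm.trans ?_
      exact congrArg B.a.toFun (Met.congr_toFun
        (R.map_comp (NExp.toHom (X := A.A) m) φ.f).symm f.2))

/-! ### Algebra laws inherited by all models of the theory -/

section Laws

variable {hR} (N : TheoryModel (monadTheory hR))

/-- The bound holds in every algebra, where `r` acts through a composite of nonexpansive maps; being
a judgment, it passes to all models. The unit and multiplication laws take the same route. -/
lemma edist_act_le {C : MetricCardinal} (r s : R.obj C.toMet) (k : C.toMet ⟶ N.obj.space) :
    edist (act N.obj r k) (act N.obj s k) ≤ edist r s := by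
  by_cases h : edist r s = ⊤
  · rw [h]
    exact le_top
  · have h' := (ENNReal.coe_toNNReal h).symm
    rw [h']
    refine (SigModel.satisfies_dist_iff (P := monadSymb R) N.obj r s _).1
      (N.property _ ?_) _
    rintro _ ⟨A, rfl⟩
    refine (SigModel.satisfies_dist_iff (P := monadSymb R) _ r s _).2 fun m => ?_
    rw [← h']
    exact (Met.edist_hom_le _ _ _).trans (Met.edist_hom_le _ _ _)

/-- The action of `R(C)` on a tuple. -/
def actHom {C : MetricCardinal} (k : C.toMet ⟶ N.obj.space) : R.obj C.toMet ⟶ N.obj.space :=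
  NExp.mk' (fun r => act N.obj r k) fun r s => edist_act_le N r s k

lemma actHom_apply {C : MetricCardinal} (k : C.toMet ⟶ N.obj.space) (r : R.obj C.toMet) :
    (actHom N k).toFun r = act N.obj r k := rfl

/-- The unit law of algebras, as the judgment that `η(i)` acts as the projection to `i`. -/
lemma eta_actHom {C : MetricCardinal} (k : C.toMet ⟶ N.obj.space) :
    R.η.app C.toMet ≫ actHom N k = k := by
  refine Met.hom_ext fun i => ?_
  refine (SigModel.satisfies_proj_iff (P := monadSymb R) N.obj ((R.η.app C.toMet).toFun i)
    i.down).1 (N.property _ ?_) _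
  rintro _ ⟨A, rfl⟩
  refine (SigModel.satisfies_proj_iff (P := monadSymb R) _ _ _).2 fun m => ?_
  change (R.η.app C.toMet ≫ R.map m.toHom ≫ A.a).toFun i = (NExp.toHom m).toFun i
  have h := R.η.naturality_assoc (NExp.toHom (X := A.A) m) A.a
  rw [A.unit] at h
  exact (Met.congr_toFun h i).symm

/-- The associativity law of algebras, with naturality of `μ`, as a composition judgment in which
`r` is applied to the symbols `g(i)`. -/
lemma act_mu {C D : MetricCardinal} (r : R.obj C.toMet) (g : C.toMet ⟶ R.obj D.toMet)
    (k : D.toMet ⟶ N.obj.space) :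
    act N.obj ((R.μ.app D.toMet).toFun ((R.map g).toFun r)) k =
      act N.obj r (g ≫ actHom N k) := by
  obtain ⟨_, h⟩ := (SigModel.satisfies_comp_iff (P := monadSymb R) N.obj r
    (fun i => g.toFun ⟨i⟩) ((R.μ.app D.toMet).toFun ((R.map g).toFun r))).1 (N.property _ (by
      rintro _ ⟨A, rfl⟩
      refine (SigModel.satisfies_comp_iff (P := monadSymb R) _ _ _ _).2 ⟨fun m i j => ?_,
        fun m => ?_⟩
      · exact (Met.edist_hom_le _ _ _).trans ((Met.edist_hom_le _ _ _).trans
          (Met.edist_hom_le g ⟨i⟩ ⟨j⟩))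
      · change (R.map (g ≫ R.map (NExp.toHom (X := A.A) m) ≫ A.a) ≫ A.a).toFun r =
          (R.map g ≫ R.μ.app D.toMet ≫ R.map (NExp.toHom (X := A.A) m) ≫ A.a).toFun r
        refine Met.congr_toFun ?_ r
        have hμ := R.μ.naturality_assoc (NExp.toHom (X := A.A) m) A.a
        rw [← hμ, A.assoc]
        simp))
  exact (h (MetricCardinal.ofHom k)).symm

/-- Reduces to `act_mu`, as `R(n)` is `R(n ≫ η)` followed by `μ`. -/
lemma act_map {C D : MetricCardinal} (r : R.obj C.toMet) (n : C.toMet ⟶ D.toMet)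
    (k : D.toMet ⟶ N.obj.space) :
    act N.obj ((R.map n).toFun r) k = act N.obj r (n ≫ k) := by
  have h := act_mu N r (n ≫ R.η.app D.toMet) k
  rw [Category.assoc, eta_actHom] at h
  rw [← h]
  congr 1
  change _ = (R.map (n ≫ R.η.app D.toMet) ≫ R.μ.app D.toMet).toFun r
  rw [R.map_comp, Category.assoc, R.right_unit]
  rfl

end Laws

/-! ### Free models -/

variable {hR} {N : TheoryModel (monadTheory hR)}

lemma exists_map_eq (hA : CountableArity R.toFunctor) {X : Met.{u}} (t : R.obj X) :
    ∃ (C : MetricCardinal) (m : C.toMet ⟶ X) (r : R.obj C.toMet), (R.map m).toFun r = t := by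
  obtain ⟨C, m, r, h⟩ := hA.exists_factor (V := PUnit.{1}) (X := X)
    ⟨fun _ => t, LipschitzWith.const' t⟩
  exact ⟨C, m, r.toFun ⟨⟩, congrFun (congrArg NExp.toFun h) ⟨⟩⟩

/-- Over a countable `E` attaining the distance in `R(X)`, both sides are actions of elements of
`R(E)` on the same tuple, where `edist_act_le` applies. This makes the extension to `R(X)` well
defined and nonexpansive. -/
lemma edist_act_comp_le (hA : CountableArity R.toFunctor) {X : Met.{u}} (h : X ⟶ N.obj.space) {C D : MetricCardinal}
    (r : R.obj C.toMet) (s : R.obj D.toMet) (m : C.toMet ⟶ X) (n : D.toMet ⟶ X) :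
    edist (act N.obj r (m ≫ h)) (act N.obj s (n ≫ h)) ≤
      edist ((R.map m).toFun r) ((R.map n).toFun s) := by
  obtain ⟨E, k, m', n', rfl, rfl, hd⟩ := hA.exists_edist_le r s m n
  rw [Category.assoc, Category.assoc, ← act_map, ← act_map]
  exact (edist_act_le N _ _ _).trans hd

variable (hA : CountableArity R.toFunctor)

/-- The extension to the free model of a map to `N`. -/
def extHom {X : Met.{u}} (h : X ⟶ N.obj.space) : R.obj X ⟶ N.obj.space :=
  NExp.mk' (fun t => act N.obj (exists_map_eq hA t).choose_spec.choose_spec.choose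
    ((exists_map_eq hA t).choose_spec.choose ≫ h)) fun t t' => by
      refine (edist_act_comp_le hA h _ _ _ _).trans ?_
      rw [(exists_map_eq hA t).choose_spec.choose_spec.choose_spec,
        (exists_map_eq hA t').choose_spec.choose_spec.choose_spec]

lemma extHom_map {X : Met.{u}} (h : X ⟶ N.obj.space) {C : MetricCardinal} (m : C.toMet ⟶ X)
    (r : R.obj C.toMet) : (extHom hA h).toFun ((R.map m).toFun r) = act N.obj r (m ≫ h) := by
  refine eq_of_edist_eq_zero (le_antisymm ((edist_act_comp_le hA h _ _ _ _).trans ?_) bot_le)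
  rw [(exists_map_eq hA _).choose_spec.choose_spec.choose_spec, edist_self]

/-- A countable tuple in `R(X)` comes from some `R(D)` with `D` countable, where the claim is
`act_mu`. -/
lemma extHom_act {X : Met.{u}} (h : X ⟶ N.obj.space) {C : MetricCardinal} (r : R.obj C.toMet)
    (m : C.toMet ⟶ R.obj X) :
    (extHom hA h).toFun ((R.μ.app X).toFun ((R.map m).toFun r)) =
      act N.obj r (m ≫ extHom hA h) := by
  obtain ⟨D, n, m', hm⟩ := hA.exists_factor (MetricCardinal.ofHom m)
  obtain rfl : m'.toHom ≫ R.map n = m :=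
    Met.hom_ext fun i => congrFun (congrArg NExp.toFun hm) i.down
  have h₁ : (R.μ.app X).toFun ((R.map (m'.toHom ≫ R.map n)).toFun r) =
      (R.map n).toFun ((R.μ.app D.toMet).toFun ((R.map m'.toHom).toFun r)) := by
    change (R.map (m'.toHom ≫ R.map n) ≫ R.μ.app X).toFun r =
      (R.map m'.toHom ≫ R.μ.app D.toMet ≫ R.map n).toFun r
    have := R.μ.naturality n
    rw [← this]
    simp
  rw [h₁, extHom_map, act_mu]
  congr 1
  rw [Category.assoc]
  congr 1
  exact Met.hom_ext fun t => (extHom_map hA h n t).symm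

/-- The extension of a map to the free model, as a homomorphism. -/
def extModelHom {X : Met.{u}} (h : X ⟶ N.obj.space) :
    (algFunctor hR).obj (R.free.obj X) ⟶ N :=
  ObjectProperty.homMk (SigModel.Hom.mk (M := algModel hR (R.free.obj X)) (N := N.obj)
    (extHom hA h) fun f m => extHom_act hA h f.2 (NExp.toHom (X := R.obj X) m))

lemma eta_extHom {X : Met.{u}} (h : X ⟶ N.obj.space) : R.η.app X ≫ extHom hA h = h := by
  refine Met.hom_ext fun x => ?_
  -- The point `x` is a tuple indexed by a one-element metric cardinal, so the action formula
  -- applies to `η(x)`.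
  obtain ⟨C, ⟨e⟩⟩ := exists_iso_metricCardinal.{u} ⟨PUnit⟩
  have hη : (R.η.app X).toFun x =
      (R.map (e.hom ≫ Met.pt x)).toFun ((R.η.app C.toMet).toFun (e.inv.toFun ⟨⟩)) :=
    Met.congr_toFun (R.η.naturality (e.hom ≫ Met.pt x)) (e.inv.toFun ⟨⟩)
  rw [Met.comp_toFun, hη, extHom_map, ← actHom_apply]
  exact Met.congr_toFun (eta_actHom N ((e.hom ≫ Met.pt x) ≫ h)) (e.inv.toFun ⟨⟩)

/-- Homomorphisms from a free model are determined by their restriction. -/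
lemma freeModel_hom_ext (hA : CountableArity R.toFunctor) {X : Met.{u}} {φ ψ : (algFunctor hR).obj (R.free.obj X) ⟶ N}
    (h : ∀ x, φ.hom.toNExp.toFun ((R.η.app X).toFun x) =
      ψ.hom.toNExp.toFun ((R.η.app X).toFun x)) : φ = ψ := by
  refine ObjectProperty.hom_ext _ (SigModel.Hom.ext (NExp.ext_apply fun t => ?_))
  obtain ⟨C, m, r, rfl⟩ := exists_map_eq hA t
  -- By a unit law of the monad, `R(m)(r)` is the symbol `r` applied to the generators `m ≫ η`.
  have key (χ : (algFunctor hR).obj (R.free.obj X) ⟶ N) :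
      χ.hom.toNExp.toFun ((R.map m).toFun r) =
        act N.obj r (m ≫ R.η.app X ≫ (χ.hom.toNExp : R.obj X ⟶ N.obj.space)) := by
    refine Eq.trans (congrArg χ.hom.toNExp.toFun ?_)
      (χ.hom.map_op ⟨C, r⟩ (MetricCardinal.ofHom (m ≫ R.η.app X)))
    change (R.map m).toFun r = (R.map (m ≫ R.η.app X) ≫ R.μ.app X).toFun r
    rw [R.map_comp, Category.assoc, R.right_unit]
    rfl
  rw [key, key]
  congr 2
  exact Met.hom_ext h

variable (hR)

/-- The free model functor is left adjoint to the forgetful functor. -/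
def freeModelAdj : R.free ⋙ algFunctor hR ⊣ TheoryModel.forget (monadTheory hR) where
  unit :=
    { app X := R.η.app X
      naturality _ _ f := R.η.naturality f }
  counit :=
    { app N := extModelHom hA (N := N) (𝟙 N.obj.space)
      naturality N N' φ := freeModel_hom_ext hA fun x => by
        have h₁ := Met.congr_toFun (eta_extHom hA (N := N) (𝟙 N.obj.space)) x
        have h₂ := Met.congr_toFun (eta_extHom hA (N := N') (𝟙 N'.obj.space))
          (φ.hom.toNExp.toFun x)
        have h₃ := Met.congr_toFun
          (R.η.naturality (φ.hom.toNExp : N.obj.space ⟶ N'.obj.space)) x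
        change (extHom hA (N := N') (𝟙 N'.obj.space)).toFun
            ((R.map (φ.hom.toNExp : N.obj.space ⟶ N'.obj.space)).toFun ((R.η.app _).toFun x)) =
          φ.hom.toNExp.toFun ((extHom hA (N := N) (𝟙 N.obj.space)).toFun ((R.η.app _).toFun x))
        exact ((congrArg (extHom hA (N := N') (𝟙 N'.obj.space)).toFun h₃).symm.trans h₂).trans
          (congrArg φ.hom.toNExp.toFun h₁).symm }
  left_triangle_components X := freeModel_hom_ext hA fun x => by
    have h₁ := Met.congr_toFun (R.η.naturality (R.η.app X)) x
    have h₂ := Met.congr_toFun (eta_extHom hA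
      (N := (algFunctor hR).obj (R.free.obj X)) (𝟙 (R.obj X))) ((R.η.app X).toFun x)
    exact (congrArg (extHom hA (N := (algFunctor hR).obj (R.free.obj X)) (𝟙 (R.obj X))).toFun
      h₁).symm.trans h₂
  right_triangle_components N := eta_extHom hA (N := N) (𝟙 N.obj.space)

/-- The counit at a free model and `μ` are both homomorphisms out of a free model that restrict to
the identity along `η`. -/
lemma freeModelAdj_mu (X : Met.{u}) : (freeModelAdj hR hA).toMonad.μ.app X = R.μ.app X := by
  let μ : R.free.obj (R.obj X) ⟶ R.free.obj X :=
    { f := R.μ.app X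
      h := R.assoc X }
  have h : extModelHom hA (N := (algFunctor hR).obj (R.free.obj X)) (𝟙 (R.obj X)) =
      (algFunctor hR).map μ := freeModel_hom_ext hA fun x =>
    (Met.congr_toFun (eta_extHom hA
      (N := (algFunctor hR).obj (R.free.obj X)) (𝟙 (R.obj X))) x).trans
      (Met.congr_toFun (R.left_unit X) x).symm
  exact congrArg (fun φ => φ.hom.toNExp) h

/-- The monad of free models is the given monad. -/
def freeModelMonadIso : (freeModelAdj hR hA).toMonad ≅ R :=
  MonadIso.mk (NatIso.ofComponents (fun X => Iso.refl (R.obj X)) fun f => by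
      exact (Category.comp_id (R.map f)).trans (Category.id_comp (R.map f)).symm)
    (fun X => Category.comp_id (R.η.app X))
    fun X => by
      refine (Category.comp_id ((freeModelAdj hR hA).toMonad.μ.app X)).trans ?_
      rw [freeModelAdj_mu]
      have h : R.map (𝟙 (R.obj X)) ≫ 𝟙 (R.obj (R.obj X)) = 𝟙 _ := by simp
      exact (congrArg (· ≫ R.μ.app X) h).symm

/-- Monads of countable arity come from metric equational theories. -/
theorem exists_comesFrom (hR : IsMetFunctor R.toFunctor)
    (hA : CountableArity R.toFunctor) : ∃ (Ω : Signature.{u}) (T : Set (Judgment Ω)),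
    IsMET T ∧ ComesFrom R T :=
  ⟨_, monadTheory hR, isMET_of_models _, _, freeModelAdj hR hA, ⟨freeModelMonadIso hR hA⟩⟩

end Monad

end MetEq

end

theorem mainTheorem2 :
    (∀ L : MetEq.LawvereTheory.{u},
      MetEq.IsMET L.theory ∧
      ∃ E : L.Model ≌ MetEq.TheoryModel L.theory,
        E.functor ⋙ MetEq.TheoryModel.forget L.theory = L.forget ∧
        ∀ (M N : L.Model) (φ ψ : M ⟶ N), edist (E.functor.map φ) (E.functor.map ψ) = edist φ ψ) ∧
    (∀ R : Monad MetEq.Met.{u}, MetEq.IsMetFunctor R.toFunctor →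
      ((∃ (Ω : MetEq.Signature.{u}) (T : Set (MetEq.Judgment Ω)),
          MetEq.IsMET T ∧ MetEq.ComesFrom R T) ↔
        MetEq.CountableArity R.toFunctor)) :=
  ⟨fun L => ⟨L.isMET_theory, L.exists_equivalence⟩, fun _ hR =>
    ⟨fun ⟨_, _, _, h⟩ => h.countableArity, fun hA => MetEq.exists_comesFrom hR hA⟩⟩
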